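/- Fix an integer $d\ge 1$ and reals $a,b,\sigma>0$, and let $$c(\sigma)=\mathbb E\Bigl[\exp\Bigl(-\frac{\|x-y\|^2}{2\sigma^2}\Bigr)\Bigr],\qquad x,y\sim\mathrm{Unif}([0,1]^d)\ \text{independent},$$ with $\|\cdot\|$ the Euclidean norm. In the latent-kernel stochastic block model on $n$ vertices, latent positions $x_1,\dots,x_n\sim\mathrm{Unif}([0,1]^d)$ are drawn independently; independently of them, labels $z_1,\dots,z_n\in\{+1,-1\}$ are drawn independently with equal probability; and, given these, each pair $\{i,j\}$ of distinct vertices is independently an edge of the graph $G$ with probability $p_{ij}=a\,\frac{\log n}{n}\,c(\sigma)$ if $z_i=z_j$ and $p_{ij}=b\,\frac{\log n}{n}\,c(\sigma)$ if $z_i\ne z_j$ (replaced by $1$ for the finitely many $n$ for which the expression exceeds $1$). An estimator is, for every $n$, a function $\hat z=\hat z(G)\in\{\pm1\}^n$ of the graph alone. It succeeds if it recovers all planted labels up to a global sign, that is, if $\hat z=z$ or $\hat z=-z$. Exact recovery is possible if for some estimator the probability of success tends to $1$ as $n\to\infty$. Write $\gamma=\bigl(\sqrt{c(\sigma)a}-\sqrt{c(\sigma)b}\bigr)^2$.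 1. If $\gamma\neq 2$, then exact recovery is possible if and only if $\gamma>2$. 2. If $\gamma<2$, then every estimator fails: its probability of success tends to $0$ as $n\to\infty$. 3. If $\gamma>2$, then every maximum-likelihood estimator (every $\hat z$ such that $\hat z(G)$ maximizes $z\mapsto\Pr(G\mid z)$ over $\{\pm1\}^n$, for all $n$ and $G$) succeeds with probability $1-o(1)$. -/

import Mathlib

open MeasureTheory ProbabilityTheory Filter Topology

noncomputable section

namespace LatentKernelSBM

/-- The latent cube `[0,1]^d` inside Euclidean `d`-space. -/
def unitCube (d : ℕ) : Set (EuclideanSpace ℝ (Fin d)) := {x | ∀ i, x i ∈ Set.Icc (0 : ℝ) 1}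

/-- The uniform law on the cube: Lebesgue measure conditioned on the cube. -/
def unifCube (d : ℕ) : Measure (EuclideanSpace ℝ (Fin d)) :=
  ProbabilityTheory.cond volume (unitCube d)

lemma volume_unitCube (d : ℕ) : volume (unitCube d) = 1 := by
  have h : unitCube d = (MeasurableEquiv.toLp 2 (Fin d → ℝ)).symm ⁻¹'
      (Set.univ.pi fun _ => Set.Icc (0 : ℝ) 1) := by
    ext x
    simp only [unitCube, Set.mem_ofPred_eq, Set.mem_preimage, Set.mem_univ_pi]
    rfl
  rw [h, (PiLp.volume_preserving_ofLp (Fin d)).measure_preimage_equiv]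
  rw [volume_pi_pi]
  simp

instance (d : ℕ) : IsProbabilityMeasure (unifCube d) :=
  cond_isProbabilityMeasure_of_finite (by simp [volume_unitCube]) (by simp [volume_unitCube])

/-- The kernel constant `c(σ) = E exp(-‖x - y‖² / (2σ²))`, for `x, y` independent and uniform
on `[0,1]^d`. -/
def kernelConst (d : ℕ) (σ : ℝ) : ℝ :=
  ∫ p, Real.exp (-‖p.1 - p.2‖ ^ 2 / (2 * σ ^ 2)) ∂(unifCube d).prod (unifCube d)

/-- Community labels in `{+1, -1}` of the vertices `Fin n`. -/
abbrev Labels (n : ℕ) : Type := Fin n → ℤˣ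

/-- The edge probability of the pair `{i, j}`: `a (log n / n) c(σ)` if `z i = z j`, and
`b (log n / n) c(σ)` otherwise. The projection to `[0,1]` changes nothing unless the value exceeds
`1`, which happens for finitely many `n` only. -/
def edgeProb (n d : ℕ) (a b σ : ℝ) (z : Labels n) (i j : Fin n) : unitInterval :=
  Set.projIcc (0 : ℝ) 1 zero_le_one
    ((if z i = z j then a else b) * (Real.log n / n) * kernelConst d σ)

/-- The unordered pairs of distinct vertices, each listed once as `(i, j)` with `i < j`. -/
abbrev VertexPair (n : ℕ) : Type := {e : Fin n × Fin n // e.1 < e.2}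

instance (n : ℕ) : MeasurableSingletonClass (SimpleGraph (Fin n)) :=
  ⟨fun G => ⟨{G.Adj}, measurableSet_singleton _, by ext H; simp⟩⟩

/-- The graph whose edges are the pairs that are switched on. -/
def graphOfPairs {n : ℕ} (ω : VertexPair n → Bool) : SimpleGraph (Fin n) :=
  SimpleGraph.fromRel fun i j => ∃ h : i < j, ω ⟨(i, j), h⟩ = true

/-- The law of the graph given the labels: the pairs are edges independently of each other, each
with its edge probability. -/
def graphLaw (n d : ℕ) (a b σ : ℝ) (z : Labels n) : Measure (SimpleGraph (Fin n)) :=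
  (Measure.pi fun e : VertexPair n =>
    bernoulliMeasure true false (edgeProb n d a b σ z e.1.1 e.1.2)).map graphOfPairs

instance (n d : ℕ) (a b σ : ℝ) (z : Labels n) : IsProbabilityMeasure (graphLaw n d a b σ z) :=
  Measure.isProbabilityMeasure_map (measurable_of_finite _).aemeasurable

/-- The law of the labels: independent, each `+1` or `-1` with equal probability. -/
def labelLaw (n : ℕ) : Measure (Labels n) :=
  Measure.pi fun _ => (PMF.uniformOfFintype ℤˣ).toMeasure

instance (n : ℕ) : IsProbabilityMeasure (labelLaw n) := by
  unfold labelLaw; infer_instance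

instance : MeasurableSingletonClass ℤˣ :=
  ⟨fun u => ⟨{(u : ℤ)}, measurableSet_singleton _, by ext v; simp [Units.ext_iff]⟩⟩

/-- `graphLaw`, as a Markov kernel from labels to graphs. -/
def graphKernel (n d : ℕ) (a b σ : ℝ) : Kernel (Labels n) (SimpleGraph (Fin n)) where
  toFun := graphLaw n d a b σ
  measurable' := measurable_of_finite _

instance (n d : ℕ) (a b σ : ℝ) : IsMarkovKernel (graphKernel n d a b σ) :=
  ⟨fun z => inferInstanceAs (IsProbabilityMeasure (graphLaw n d a b σ z))⟩

/-- The latent-kernel stochastic block model on `n` vertices: the joint law of the latent positions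
(independent, uniform on `[0,1]^d`), the labels and the graph. The positions enter the edge
probabilities only through the kernel constant. -/
def sbm (n d : ℕ) (a b σ : ℝ) :
    Measure ((Fin n → EuclideanSpace ℝ (Fin d)) × Labels n × SimpleGraph (Fin n)) :=
  (Measure.pi fun _ => unifCube d).prod ((labelLaw n).compProd (graphKernel n d a b σ))

instance (n d : ℕ) (a b σ : ℝ) : IsProbabilityMeasure (sbm n d a b σ) := by
  unfold sbm; infer_instance

/-- An estimator of the labels: for each `n`, a function of the observed graph. -/
abbrev Estimator : Type := ∀ n : ℕ, SimpleGraph (Fin n) → Labels n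

/-- The probability that the estimator recovers the planted labels of all vertices. As the law of
the graph does not change when all labels are negated, this is up to a global sign. -/
def successProb (d : ℕ) (a b σ : ℝ) (zhat : Estimator) (n : ℕ) : ℝ :=
  (sbm n d a b σ).real {ω | zhat n ω.2.2 = ω.2.1 ∨ zhat n ω.2.2 = -ω.2.1}

/-- Exact recovery is achievable: some estimator succeeds with probability tending to `1`. -/
def ExactRecoveryAchievable (d : ℕ) (a b σ : ℝ) : Prop :=
  ∃ zhat : Estimator, Tendsto (successProb d a b σ zhat) atTop (𝓝 1)

/-- The likelihood of the labels `z` when the graph `G` is observed. -/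
def likelihood (n d : ℕ) (a b σ : ℝ) (z : Labels n) (G : SimpleGraph (Fin n)) : ℝ :=
  (graphLaw n d a b σ z).real {G}

/-- A maximum-likelihood estimator, with ties broken arbitrarily. -/
def IsMLE (d : ℕ) (a b σ : ℝ) (zhat : Estimator) : Prop :=
  ∀ (n : ℕ) (G : SimpleGraph (Fin n)) (z : Labels n),
    likelihood n d a b σ z G ≤ likelihood n d a b σ (zhat n G) G

end LatentKernelSBM

end

/-! The latent positions are independent of labels and graph, so they integrate out. What remains is
the two-community block model with `p = α log n / n` and `q = β log n / n`, up to clipping, where `α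
= c(σ) a` and `β = c(σ) b`.

Above the threshold: if a maximum-likelihood estimator errs, some `z'` other than `±z` is at least
as likely as the planted `z`. The probability of this is at most the Bhattacharyya sum `∑ √(weight z
* weight z')`, which factors over pairs (`sum_sqrt_weight_mul_weight`). If `z` and `z'` differ at
`k` vertices, then `k (n - k)` pairs change type, and each contributes a factor at most `exp (-(γ/2)
log n / n)`. The resulting union bound `∑ C(n,k) n ^ (-(γ/2) k (n - k) / n)` tends to `0` as soon as
`γ/2 > 1`.

Below the threshold: call a vertex tied if it has exactly `k` neighbours in each community, with `k`
about `√(αβ) log n / 2`. For nearly balanced labels, flipping a tied vertex costs at most a factor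
`2` in likelihood (`weight_le_two_mul_weight_flipAt`). Hence if at least `M` vertices are tied, `z`
carries at most a fraction `2/M` of the posterior mass. An estimator covers only two labelings per
graph, so its success probability is at most `4/M` plus the probability that the labels are
unbalanced or ties are scarce (`sum_configLaw_real_success_le`). This treats every estimator at
once, without optimality of maximum likelihood.

Ties abound: the two neighbour counts are nearly Poisson with means `α log n / 2` and `β log n / 2`,
so a vertex is tied with probability `n ^ (-γ/2 + o(1))`. The expected number of ties thus exceeds a
positive power of `n` when `γ < 2`, and a second-moment argument gives concentration. -/

namespace LatentKernelSBM

/-! ### The block model with two edge probabilities -/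

/-- The edge probability of a pair: `p` inside a community, `q` across. -/
noncomputable def blockProb {n : ℕ} (p q : unitInterval) (z : Labels n) (i j : Fin n) :
    unitInterval :=
  if z i = z j then p else q

/-- The law of the family of edge indicators, given the labels. -/
noncomputable def configLaw {n : ℕ} (p q : unitInterval) (z : Labels n) :
    Measure (VertexPair n → Bool) :=
  Measure.pi fun e : VertexPair n => bernoulliMeasure true false (blockProb p q z e.1.1 e.1.2)

instance {n : ℕ} (p q : unitInterval) (z : Labels n) :
    IsProbabilityMeasure (configLaw p q z) := by
  unfold configLaw; infer_instance

/-- The mass that a Bernoulli law of parameter `s` gives to `x`. -/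
noncomputable def bernoulliWeight (s : ℝ) (x : Bool) : ℝ := if x then s else 1 - s

lemma bernoulliWeight_nonneg (s : unitInterval) (x : Bool) : 0 ≤ bernoulliWeight s x := by
  unfold bernoulliWeight; split_ifs
  · exact s.2.1
  · exact sub_nonneg.2 s.2.2

lemma bernoulliMeasure_real_singleton (s : unitInterval) (x : Bool) :
    (bernoulliMeasure true false s).real {x} = bernoulliWeight s x := by
  rw [bernoulliMeasure_real_apply s (measurableSet_singleton x)]
  cases x <;> simp [bernoulliWeight]

/-- The likelihood of the labels `z` when the edge indicators are `ω`. -/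
noncomputable def weight {n : ℕ} (p q : unitInterval) (z : Labels n) (ω : VertexPair n → Bool) :
    ℝ :=
  ∏ e : VertexPair n, bernoulliWeight (blockProb p q z e.1.1 e.1.2) (ω e)

lemma weight_nonneg {n : ℕ} (p q : unitInterval) (z : Labels n) (ω : VertexPair n → Bool) :
    0 ≤ weight p q z ω :=
  Finset.prod_nonneg fun _ _ => bernoulliWeight_nonneg _ _

lemma configLaw_real_singleton {n : ℕ} (p q : unitInterval) (z : Labels n)
    (ω : VertexPair n → Bool) : (configLaw p q z).real {ω} = weight p q z ω := by
  rw [measureReal_def, configLaw, Measure.pi_singleton, ENNReal.toReal_prod]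
  exact Finset.prod_congr rfl fun e _ => bernoulliMeasure_real_singleton _ _

lemma configLaw_real_apply {n : ℕ} (p q : unitInterval) (z : Labels n)
    (S : Set (VertexPair n → Bool)) [DecidablePred (· ∈ S)] :
    (configLaw p q z).real S = ∑ ω with ω ∈ S, weight p q z ω := by
  have h : S = ((Finset.univ.filter (· ∈ S) : Finset (VertexPair n → Bool)) : Set _) := by
    ext; simp
  conv_lhs => rw [h, ← sum_measureReal_singleton]
  exact Finset.sum_congr rfl fun ω _ => configLaw_real_singleton p q z ω

lemma sum_weight {n : ℕ} (p q : unitInterval) (z : Labels n) :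
    ∑ ω, weight p q z ω = 1 := by
  classical
  have := configLaw_real_apply p q z Set.univ
  simpa using this.symm

lemma graphOfPairs_adj {n : ℕ} (ω : VertexPair n → Bool) {i j : Fin n} (h : i < j) :
    (graphOfPairs ω).Adj i j ↔ ω ⟨(i, j), h⟩ = true := by
  simp only [graphOfPairs, SimpleGraph.fromRel_adj]
  constructor
  · rintro ⟨_, ⟨_, h'⟩ | ⟨h', _⟩⟩
    · exact h'
    · exact absurd h (lt_asymm h')
  · exact fun h' => ⟨h.ne, Or.inl ⟨h, h'⟩⟩

lemma graphOfPairs_injective {n : ℕ} : Function.Injective (graphOfPairs (n := n)) := by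
  intro ω ω' h
  ext ⟨⟨i, j⟩, hij⟩
  rw [Bool.eq_iff_iff, ← graphOfPairs_adj ω hij, ← graphOfPairs_adj ω' hij, h]

/-! ### Reduction of the frozen model to the block model -/

/-- The edge probability `a (log n / n) c(σ)`, projected to `[0,1]`. -/
noncomputable def levelProb (n d : ℕ) (a σ : ℝ) : unitInterval :=
  Set.projIcc (0 : ℝ) 1 zero_le_one (a * (Real.log n / n) * kernelConst d σ)

lemma edgeProb_eq (n d : ℕ) (a b σ : ℝ) (z : Labels n) (i j : Fin n) :
    edgeProb n d a b σ z i j = blockProb (levelProb n d a σ) (levelProb n d b σ) z i j := by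
  unfold edgeProb blockProb levelProb
  split_ifs <;> rfl

lemma graphLaw_eq (n d : ℕ) (a b σ : ℝ) (z : Labels n) :
    graphLaw n d a b σ z =
      (configLaw (levelProb n d a σ) (levelProb n d b σ) z).map graphOfPairs := by
  simp only [graphLaw, configLaw, edgeProb_eq]

lemma graphLaw_real (n d : ℕ) (a b σ : ℝ) (z : Labels n) (S : Set (SimpleGraph (Fin n))) :
    (graphLaw n d a b σ z).real S =
      (configLaw (levelProb n d a σ) (levelProb n d b σ) z).real (graphOfPairs ⁻¹' S) := by
  rw [graphLaw_eq, map_measureReal_apply (measurable_of_finite _) (Set.toFinite S).measurableSet]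

lemma likelihood_graphOfPairs (n d : ℕ) (a b σ : ℝ) (z : Labels n) (ω : VertexPair n → Bool) :
    likelihood n d a b σ z (graphOfPairs ω) =
      weight (levelProb n d a σ) (levelProb n d b σ) z ω := by
  rw [likelihood, graphLaw_real, ← configLaw_real_singleton]
  congr 1
  ext ω'
  simp [graphOfPairs_injective.eq_iff]

lemma labelLaw_real_singleton (n : ℕ) (z : Labels n) : (labelLaw n).real {z} = (2 ^ n)⁻¹ := by
  rw [measureReal_def, labelLaw, Measure.pi_singleton, ENNReal.toReal_prod]
  have h (i : Fin n) : ((PMF.uniformOfFintype ℤˣ).toMeasure {z i}).toReal = 2⁻¹ := by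
    rw [PMF.toMeasure_apply_singleton _ _ (measurableSet_singleton _)]
    simp
  rw [Finset.prod_congr rfl fun i _ => h i]
  simp

/-- The success event does not involve the positions, so their factor of the product measure has
mass `1`. From here on only finite sums over labels and edge indicators occur. -/
lemma successProb_eq (d : ℕ) (a b σ : ℝ) (zhat : Estimator) (n : ℕ) :
    successProb d a b σ zhat n =
      ∑ z : Labels n, (2 ^ n)⁻¹ *
        (configLaw (levelProb n d a σ) (levelProb n d b σ) z).real
          {ω | zhat n (graphOfPairs ω) = z ∨ zhat n (graphOfPairs ω) = -z} := by
  set T : Set (Labels n × SimpleGraph (Fin n)) := {x | zhat n x.2 = x.1 ∨ zhat n x.2 = -x.1}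
  have hT : MeasurableSet T := (Set.toFinite T).measurableSet
  have h1 : successProb d a b σ zhat n =
      ((labelLaw n).compProd (graphKernel n d a b σ)).real T := by
    have : {ω : (Fin n → EuclideanSpace ℝ (Fin d)) × Labels n × SimpleGraph (Fin n) |
        zhat n ω.2.2 = ω.2.1 ∨ zhat n ω.2.2 = -ω.2.1} = Set.univ ×ˢ T := by
      ext; simp [T]
    rw [successProb, this, sbm, measureReal_prod_prod]
    simp
  rw [h1, measureReal_def, Measure.compProd_apply hT, lintegral_fintype,
    ENNReal.toReal_sum fun z _ => ENNReal.mul_ne_top (measure_ne_top _ _) (measure_ne_top _ _)]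
  refine Finset.sum_congr rfl fun z _ => ?_
  rw [ENNReal.toReal_mul, mul_comm]
  congr 1
  · exact labelLaw_real_singleton n z
  · exact graphLaw_real n d a b σ z _

/-! ### Error of the maximum-likelihood estimator -/

/-- The Bhattacharyya coefficient of two Bernoulli laws. -/
noncomputable def affinity (p q : ℝ) : ℝ := √(p * q) + √((1 - p) * (1 - q))

lemma affinity_nonneg (p q : ℝ) : 0 ≤ affinity p q := by unfold affinity; positivity

/-- AM-GM on `√((1 - p) * (1 - q))` leaves `1 - (p + q) / 2 + √(p * q)`, which is the right side.
Since `p` and `q` scale with `log n / n`, this is where `γ` enters. -/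
lemma affinity_le_sub (p q : unitInterval) :
    affinity p q ≤ 1 - (√(p : ℝ) - √(q : ℝ)) ^ 2 / 2 := by
  have hp := p.2; have hq := q.2
  simp only [Set.mem_Icc] at hp hq
  have h1 : √((1 - p : ℝ) * (1 - q)) ≤ ((1 - p) + (1 - q)) / 2 := by
    rw [Real.sqrt_le_left (by linarith)]
    nlinarith [sq_nonneg ((p : ℝ) - q)]
  have h2 := Real.sq_sqrt hp.1
  have h3 := Real.sq_sqrt hq.1
  unfold affinity
  rw [Real.sqrt_mul hp.1]
  nlinarith

lemma affinity_le_one (p q : unitInterval) : affinity p q ≤ 1 :=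
  (affinity_le_sub p q).trans (by nlinarith [sq_nonneg (√(p : ℝ) - √(q : ℝ))])

lemma sum_sqrt_weight_mul_weight {n : ℕ} (p q : unitInterval) (z z' : Labels n) :
    ∑ ω, √(weight p q z ω * weight p q z' ω) =
      ∏ e : VertexPair n,
        affinity (blockProb p q z e.1.1 e.1.2) (blockProb p q z' e.1.1 e.1.2) := by
  have h (e : VertexPair n) :
      affinity (blockProb p q z e.1.1 e.1.2) (blockProb p q z' e.1.1 e.1.2) =
        ∑ x, √(bernoulliWeight (blockProb p q z e.1.1 e.1.2) x *
          bernoulliWeight (blockProb p q z' e.1.1 e.1.2) x) := by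
    simp [affinity, bernoulliWeight]
  rw [Finset.prod_congr rfl fun e _ => h e, Fintype.prod_sum]
  refine Finset.sum_congr rfl fun ω _ => ?_
  rw [weight, weight, ← Finset.prod_mul_distrib, Real.sqrt_prod]
  exact fun e _ => mul_nonneg (bernoulliWeight_nonneg _ _) (bernoulliWeight_nonneg _ _)

/-- The vertices on which two labelings differ. -/
def disagreement {n : ℕ} (z z' : Labels n) : Finset (Fin n) := {i | z i ≠ z' i}

lemma eq_neg_of_mem_disagreement {n : ℕ} {z z' : Labels n} {i : Fin n}
    (h : i ∈ disagreement z z') : z' i = -z i := by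
  have h : z i ≠ z' i := by simpa [disagreement] using h
  rcases Int.units_eq_one_or (z i) with h1 | h1 <;> rcases Int.units_eq_one_or (z' i) with h2 | h2
    <;> simp_all

lemma eq_of_notMem_disagreement {n : ℕ} {z z' : Labels n} {i : Fin n}
    (h : i ∉ disagreement z z') : z' i = z i := by
  by_contra hc
  exact h (by simpa [disagreement] using fun h' => hc h'.symm)

lemma disagreement_injective {n : ℕ} (z : Labels n) : Function.Injective (disagreement z) := by
  intro z₁ z₂ h
  ext1 i
  by_cases hi : i ∈ disagreement z z₁
  · rw [eq_neg_of_mem_disagreement hi, eq_neg_of_mem_disagreement (z := z) (z' := z₂) (h ▸ hi)]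
  · rw [eq_of_notMem_disagreement hi, eq_of_notMem_disagreement (z := z) (z' := z₂) (h ▸ hi)]

lemma units_eq_neg_iff (u v : ℤˣ) : u = -v ↔ ¬ u = v := by
  rcases Int.units_eq_one_or u with rfl | rfl <;> rcases Int.units_eq_one_or v with rfl | rfl <;>
    decide

/-- A pair changes type when exactly one endpoint lies in the disagreement set `S`; orienting such
pairs from `S` outwards covers `S ×ˢ Sᶜ`. An inequality is enough, because affinities are at most
`1`. -/
lemma card_mul_card_compl_le {n : ℕ} (z z' : Labels n) :
    (disagreement z z').card * (n - (disagreement z z').card) ≤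
      (Finset.univ.filter fun e : VertexPair n =>
        ¬ (z e.1.1 = z e.1.2 ↔ z' e.1.1 = z' e.1.2)).card := by
  set S := disagreement z z'
  have hc : n - S.card = Sᶜ.card := by rw [Finset.card_compl, Fintype.card_fin]
  rw [hc, ← Finset.card_product]
  refine Finset.card_le_card_of_surjOn
    (fun e => if e.1.1 ∈ S then e.1 else e.1.swap) ?_
  rintro ⟨i, j⟩ hij
  obtain ⟨hi, hj⟩ : i ∈ S ∧ j ∉ S := by simpa using hij
  have hi' := eq_neg_of_mem_disagreement hi
  have hj' := eq_of_notMem_disagreement hj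
  rcases lt_trichotomy i j with h | h | h
  · refine ⟨⟨(i, j), h⟩, ?_, by simp [hi]⟩
    simp only [Finset.coe_filter, Finset.mem_univ, true_and, Set.mem_ofPred_eq, hi', hj']
    rw [neg_eq_iff_eq_neg, units_eq_neg_iff]; tauto
  · exact absurd (h ▸ hi) hj
  · refine ⟨⟨(j, i), h⟩, ?_, by simp [hj]⟩
    simp only [Finset.coe_filter, Finset.mem_univ, true_and, Set.mem_ofPred_eq, hi', hj']
    rw [units_eq_neg_iff]; tauto

lemma sum_sqrt_weight_le {n : ℕ} (p q : unitInterval) (z z' : Labels n) :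
    ∑ ω, √(weight p q z ω * weight p q z' ω) ≤
      affinity p q ^ ((disagreement z z').card * (n - (disagreement z z').card)) := by
  rw [sum_sqrt_weight_mul_weight]
  refine le_trans ?_ (pow_le_pow_of_le_one (affinity_nonneg _ _) (affinity_le_one p q)
    (card_mul_card_compl_le z z'))
  rw [← Finset.prod_const, Finset.prod_filter]
  refine Finset.prod_le_prod (fun _ _ => affinity_nonneg _ _) fun e _ => ?_
  have hself (s : unitInterval) : affinity s s ≤ 1 := affinity_le_one s s
  have hsymm : affinity q p = affinity p q := by
    simp [affinity, mul_comm]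
  unfold blockProb
  by_cases h1 : z e.1.1 = z e.1.2 <;> by_cases h2 : z' e.1.1 = z' e.1.2 <;>
    simp [h1, h2, hself, hsymm]

/-- On failure `e ω` is a competitor with `weight z ≤ weight (e ω)`, so `weight z ≤ √(weight z *
weight (e ω))`, one of the terms of the union bound. Competitors are then grouped by the size of
their disagreement set with `z`. -/
lemma configLaw_real_fail_le {n : ℕ} (p q : unitInterval) (z : Labels n)
    (e : (VertexPair n → Bool) → Labels n) (he : ∀ ω z', weight p q z' ω ≤ weight p q (e ω) ω) :
    (configLaw p q z).real {ω | ¬ (e ω = z ∨ e ω = -z)} ≤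
      ∑ k ∈ Finset.Ioo 0 n, (n.choose k : ℝ) * affinity p q ^ (k * (n - k)) := by
  classical
  set A : Finset (Labels n) := {z' | ¬ (z' = z ∨ z' = -z)}
  have h1 : (configLaw p q z).real {ω | ¬ (e ω = z ∨ e ω = -z)} ≤
      ∑ z' ∈ A, ∑ ω, √(weight p q z ω * weight p q z' ω) := by
    rw [configLaw_real_apply, Finset.sum_comm, Finset.sum_filter]
    refine Finset.sum_le_sum fun ω _ => ?_
    have hnn : 0 ≤ ∑ z' ∈ A, √(weight p q z ω * weight p q z' ω) :=
      Finset.sum_nonneg fun _ _ => Real.sqrt_nonneg _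
    split_ifs with h
    · have hA : e ω ∈ A := by simpa [A] using h
      refine le_trans ?_ (Finset.single_le_sum
        (f := fun z' => √(weight p q z ω * weight p q z' ω))
        (fun _ _ => Real.sqrt_nonneg _) hA)
      refine Real.le_sqrt_of_sq_le ?_
      rw [sq]
      exact mul_le_mul_of_nonneg_left (he ω z) (weight_nonneg _ _ _ _)
    · exact hnn
  refine h1.trans ((Finset.sum_le_sum fun z' _ => sum_sqrt_weight_le p q z z').trans ?_)
  set f : ℕ → ℝ := fun k => affinity p q ^ (k * (n - k))
  have hf (k : ℕ) : 0 ≤ f k := pow_nonneg (affinity_nonneg _ _) _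
  -- The sizes `0` and `n` belong to `z` and `-z`, which are not competitors. Putting `0` there
  -- allows the sum to be extended to all subsets.
  let g : ℕ → ℝ := fun k => if k ∈ Finset.Ioo 0 n then f k else 0
  have h2 : ∑ z' ∈ A, f (disagreement z z').card = ∑ z' ∈ A, g (disagreement z z').card := by
    refine Finset.sum_congr rfl fun z' hz' => ?_
    have hz' : ¬ z' = z ∧ ¬ z' = -z := by simpa [A] using hz'
    have : (disagreement z z').card ∈ Finset.Ioo 0 n := by
      rw [Finset.mem_Ioo, Finset.card_pos]
      constructor
      · by_contra hne
        rw [Finset.not_nonempty_iff_eq_empty] at hne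
        exact hz'.1 (funext fun i => eq_of_notMem_disagreement (z := z) (by simp [hne]))
      · refine lt_of_le_of_ne (by simpa using Finset.card_le_univ (disagreement z z')) fun hn => ?_
        have : disagreement z z' = Finset.univ := by
          rw [← Finset.card_eq_iff_eq_univ, hn, Fintype.card_fin]
        exact hz'.2 (funext fun i => eq_neg_of_mem_disagreement (by simp [this]))
    simp only [g, if_pos this]
  have hg (k : ℕ) : 0 ≤ g k := by simp only [g]; split_ifs <;> simp [hf]
  calc ∑ z' ∈ A, f (disagreement z z').card
      = ∑ S ∈ A.image (disagreement z), g S.card := by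
        rw [h2, Finset.sum_image fun _ _ _ _ h => disagreement_injective z h]
    _ ≤ ∑ S ∈ (Finset.univ : Finset (Fin n)).powerset, g S.card :=
        Finset.sum_le_sum_of_subset_of_nonneg (fun _ _ => by simp) fun _ _ _ => hg _
    _ = ∑ k ∈ Finset.Ioo 0 n, (n.choose k : ℝ) * f k := by
        rw [Finset.sum_powerset_apply_card, Finset.card_univ, Fintype.card_fin]
        symm
        apply Finset.sum_subset_zero_on_sdiff
        · intro k; simp only [Finset.mem_Ioo, Finset.mem_range]; omega
        · intro k hk
          rw [Finset.mem_sdiff] at hk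
          simp [g, -Finset.mem_Ioo, hk.2]
        · intro k hk
          simp [g, -Finset.mem_Ioo, hk]

/-! ### The union bound over all labelings -/

/-- Two regimes. For `k ≤ ε n`, use `C(n,k) ≤ n ^ k`: the exponential gains at least `n ^ (s (1 - ε)
k)`, which wins by `h1`. For larger `k`, use `C(n,k) ≤ 2 ^ n`: here `n ≤ k / ε`, and `1 - k / n ≥
1/2` leaves a gain of `n ^ (s k / 2)`, which wins by `h2` once `n` is large. -/
lemma choose_mul_exp_le {s ε δ : ℝ} {n k : ℕ} (hε : 0 < ε) (hs : 0 < s) (h1 : 1 + δ ≤ s * (1 - ε))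
    (h2 : Real.log 2 / ε ≤ (s / 2 - δ) * Real.log n) (hk : 0 < k) (hkn : 2 * k ≤ n) :
    (n.choose k : ℝ) * Real.exp (-(s * (Real.log n / n)) * (k * (n - k : ℕ))) ≤
      Real.exp (-(δ * Real.log n)) ^ k := by
  have hn : 0 < n := by omega
  have hn' : (0 : ℝ) < n := by exact_mod_cast hn
  have hk' : (0 : ℝ) < k := by exact_mod_cast hk
  have hkn' : 2 * (k : ℝ) ≤ n := by exact_mod_cast hkn
  have hL : 0 ≤ Real.log n := Real.log_natCast_nonneg n
  rw [Nat.cast_sub (by omega), ← Real.exp_nat_mul]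
  have key : s * (Real.log n / n) * (k * (n - k)) = s * Real.log n * k * (1 - k / n) := by
    field_simp
  by_cases hc : (k : ℝ) ≤ ε * n
  · have hch : (n.choose k : ℝ) ≤ Real.exp (k * Real.log n) := by
      rw [Real.exp_nat_mul, Real.exp_log hn']
      exact_mod_cast Nat.choose_le_pow n k
    refine (mul_le_mul_of_nonneg_right hch (Real.exp_nonneg _)).trans ?_
    rw [← Real.exp_add, Real.exp_le_exp, neg_mul, key]
    have : 1 - ε ≤ 1 - k / n := by
      have : (k : ℝ) / n ≤ ε := (div_le_iff₀ hn').2 hc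
      linarith
    have h3 : s * (1 - ε) ≤ s * (1 - k / n) := mul_le_mul_of_nonneg_left this hs.le
    have h4 : (1 + δ) * (Real.log n * k) ≤ s * (1 - k / n) * (Real.log n * k) :=
      mul_le_mul_of_nonneg_right (h1.trans h3) (by positivity)
    nlinarith
  · have hch : (n.choose k : ℝ) ≤ Real.exp (n * Real.log 2) := by
      rw [Real.exp_nat_mul, Real.exp_log two_pos]
      exact_mod_cast Nat.choose_le_two_pow n k
    refine (mul_le_mul_of_nonneg_right hch (Real.exp_nonneg _)).trans ?_
    rw [← Real.exp_add, Real.exp_le_exp, neg_mul, key]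
    have h3 : 1 / 2 ≤ 1 - (k : ℝ) / n := by
      have : (k : ℝ) / n ≤ 1 / 2 := by rw [div_le_iff₀ hn']; linarith
      linarith
    have h4 : s * Real.log n * k * (1 / 2) ≤ s * Real.log n * k * (1 - k / n) :=
      mul_le_mul_of_nonneg_left h3 (by positivity)
    have h5 : n * Real.log 2 ≤ k * (Real.log 2 / ε) := by
      rw [mul_div_assoc', le_div_iff₀ hε]
      have := Real.log_pos one_lt_two
      push Not at hc
      nlinarith
    have h6 := mul_le_mul_of_nonneg_left h2 hk'.le
    nlinarith

lemma sum_choose_mul_exp_le {s ε δ : ℝ} {n : ℕ} (hε : 0 < ε) (hs : 0 < s) (hδ : 0 < δ)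
    (h1 : 1 + δ ≤ s * (1 - ε)) (h2 : Real.log 2 / ε ≤ (s / 2 - δ) * Real.log n) (hn : 1 < n) :
    ∑ k ∈ Finset.Ioo 0 n,
      (n.choose k : ℝ) * Real.exp (-(s * (Real.log n / n)) * (k * (n - k : ℕ))) ≤
      2 * (Real.exp (-(δ * Real.log n)) / (1 - Real.exp (-(δ * Real.log n)))) := by
  set r := Real.exp (-(δ * Real.log n))
  have hr0 : 0 < r := Real.exp_pos _
  have hr1 : r < 1 := by
    rw [Real.exp_lt_one_iff]
    have := Real.log_pos (by exact_mod_cast hn : (1 : ℝ) < n)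
    nlinarith
  -- The summand is symmetric under `k ↦ n - k`; adding both powers avoids splitting the sum at `n /
  -- 2`.
  have hterm : ∀ k ∈ Finset.Ioo 0 n,
      (n.choose k : ℝ) * Real.exp (-(s * (Real.log n / n)) * (k * (n - k : ℕ))) ≤
        r ^ k + r ^ (n - k) := by
    intro k hk
    rw [Finset.mem_Ioo] at hk
    by_cases h : 2 * k ≤ n
    · have := choose_mul_exp_le hε hs h1 h2 hk.1 h
      have := pow_pos hr0 (n - k)
      linarith
    · have := choose_mul_exp_le (k := n - k) hε hs h1 h2 (by omega) (by omega)
      rw [Nat.choose_symm hk.2.le, Nat.sub_sub_self hk.2.le, mul_comm ((n - k : ℕ) : ℝ)] at this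
      have := pow_pos hr0 k
      linarith
  have hgeom : ∑ k ∈ Finset.Ioo 0 n, r ^ k ≤ r / (1 - r) := by
    have hsum := (hasSum_geometric_of_lt_one hr0.le hr1).mul_left r
    have e1 : ∑ k ∈ Finset.Ioo 0 n, r ^ k = ∑ k ∈ Finset.range (n - 1), r * r ^ k := by
      rw [Finset.sum_nbij' (fun k => k - 1) (fun k => k + 1)]
      · intro k; simp only [Finset.mem_Ioo, Finset.mem_range]; omega
      · intro k; simp only [Finset.mem_Ioo, Finset.mem_range]; omega
      · intro k; simp only [Finset.mem_Ioo]; omega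
      · intro k; simp
      · intro k hk
        rw [Finset.mem_Ioo] at hk
        rw [← pow_succ', Nat.sub_add_cancel hk.1]
    rw [e1, div_eq_mul_inv]
    exact sum_le_hasSum _ (fun k _ => by positivity) hsum
  have hrefl : ∑ k ∈ Finset.Ioo 0 n, r ^ (n - k) = ∑ k ∈ Finset.Ioo 0 n, r ^ k := by
    refine Finset.sum_nbij' (fun k => n - k) (fun k => n - k) ?_ ?_ ?_ ?_ ?_ <;> intro k <;>
      simp only [Finset.mem_Ioo] <;> first | omega | simp
  refine (Finset.sum_le_sum hterm).trans ?_
  rw [Finset.sum_add_distrib, hrefl]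
  linarith

lemma tendsto_sum_choose_mul_exp {s : ℝ} (hs : 1 < s) :
    Tendsto (fun n : ℕ => ∑ k ∈ Finset.Ioo 0 n,
      (n.choose k : ℝ) * Real.exp (-(s * (Real.log n / n)) * (k * (n - k : ℕ)))) atTop (𝓝 0) := by
  obtain ⟨ε, δ, hε, hδ, h1, h3⟩ : ∃ ε δ : ℝ, 0 < ε ∧ 0 < δ ∧ 1 + δ ≤ s * (1 - ε) ∧ δ < s / 2 := by
    -- This `ε` makes `s * (1 - ε)` the midpoint of `1` and `s`; the cap `1 / 4` keeps `δ` below `s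
    -- / 2`.
    refine ⟨(s - 1) / (2 * s), min ((s - 1) / 2) (1 / 4), by positivity, ?_, ?_, ?_⟩
    · have : 0 < s - 1 := by linarith
      positivity
    · have : s * (1 - (s - 1) / (2 * s)) = 1 + (s - 1) / 2 := by field_simp; ring
      rw [this]
      linarith [min_le_left ((s - 1) / 2) (1 / 4 : ℝ)]
    · linarith [min_le_right ((s - 1) / 2) (1 / 4 : ℝ)]
  have hlog : Tendsto (fun n : ℕ => Real.log n) atTop atTop :=
    Real.tendsto_log_atTop.comp tendsto_natCast_atTop_atTop
  have hr : Tendsto (fun n : ℕ => Real.exp (-(δ * Real.log n))) atTop (𝓝 0) :=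
    Real.tendsto_exp_neg_atTop_nhds_zero.comp (hlog.const_mul_atTop hδ)
  have hlim : Tendsto (fun n : ℕ => 2 * (Real.exp (-(δ * Real.log n)) /
      (1 - Real.exp (-(δ * Real.log n))))) atTop (𝓝 0) := by
    simpa using (hr.div (tendsto_const_nhds.sub hr) (by simp)).const_mul 2
  refine squeeze_zero' (Eventually.of_forall fun n => Finset.sum_nonneg fun k _ => by positivity)
    ?_ hlim
  filter_upwards [(hlog.const_mul_atTop (sub_pos.2 h3)).eventually_ge_atTop (Real.log 2 / ε),
    eventually_gt_atTop 1] with n hn hn1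
  exact sum_choose_mul_exp_le hε (by linarith) hδ h1 hn hn1

/-! ### Edge probabilities at the logarithmic scale -/

lemma kernelConst_pos (d : ℕ) (σ : ℝ) : 0 < kernelConst d σ := by
  unfold kernelConst
  refine integral_exp_pos ?_
  refine Integrable.of_bound (C := 1) (by fun_prop) (ae_of_all _ fun p => ?_)
  rw [Real.norm_eq_abs, Real.abs_exp, Real.exp_le_one_iff]
  exact div_nonpos_of_nonpos_of_nonneg (neg_nonpos.2 (by positivity)) (by positivity)

lemma tendsto_log_div_natCast : Tendsto (fun n : ℕ => Real.log n / n) atTop (𝓝 0) :=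
  Real.isLittleO_log_id_atTop.tendsto_div_nhds_zero.comp tendsto_natCast_atTop_atTop

lemma eventually_levelProb (d : ℕ) {a : ℝ} (ha : 0 < a) (σ : ℝ) :
    ∀ᶠ n : ℕ in atTop,
      (levelProb n d a σ : ℝ) = kernelConst d σ * a * (Real.log n / n) := by
  have h : Tendsto (fun n : ℕ => a * (Real.log n / n) * kernelConst d σ) atTop (𝓝 0) := by
    simpa using (tendsto_log_div_natCast.const_mul a).mul_const (kernelConst d σ)
  filter_upwards [h.eventually_le_const one_pos] with n hn
  have h0 : 0 ≤ a * (Real.log n / n) * kernelConst d σ :=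
    mul_nonneg (mul_nonneg ha.le (div_nonneg (Real.log_natCast_nonneg n) n.cast_nonneg))
      (kernelConst_pos d σ).le
  rw [levelProb, Set.projIcc_of_mem zero_le_one ⟨h0, hn⟩]
  ring

theorem tendsto_successProb_of_isMLE (d : ℕ) {a b σ : ℝ} (ha : 0 < a) (hb : 0 < b)
    (hγ : 2 < (√(kernelConst d σ * a) - √(kernelConst d σ * b)) ^ 2)
    {zhat : Estimator} (hz : IsMLE d a b σ zhat) :
    Tendsto (successProb d a b σ zhat) atTop (𝓝 1) := by
  set γ := (√(kernelConst d σ * a) - √(kernelConst d σ * b)) ^ 2 with hγd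
  have hlim := (tendsto_sum_choose_mul_exp (s := γ / 2) (by linarith)).const_sub 1
  rw [sub_zero] at hlim
  refine tendsto_of_tendsto_of_tendsto_of_le_of_le' hlim tendsto_const_nhds ?_
    (Eventually.of_forall fun n => measureReal_le_one)
  filter_upwards [eventually_levelProb d ha σ, eventually_levelProb d hb σ] with n hp hq
  set p := levelProb n d a σ
  set q := levelProb n d b σ
  have haff : affinity p q ≤ Real.exp (-(γ / 2 * (Real.log n / n))) := by
    refine (affinity_le_sub p q).trans ?_
    have hc := (kernelConst_pos d σ).le
    rw [hp, hq, Real.sqrt_mul (x := kernelConst d σ * a) (by positivity),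
      Real.sqrt_mul (x := kernelConst d σ * b) (by positivity), ← sub_mul, mul_pow, ← hγd,
      Real.sq_sqrt (div_nonneg (Real.log_natCast_nonneg n) n.cast_nonneg)]
    have := Real.add_one_le_exp (-(γ / 2 * (Real.log n / n)))
    linarith
  rw [successProb_eq]
  set B := ∑ k ∈ Finset.Ioo 0 n,
    (n.choose k : ℝ) * Real.exp (-(γ / 2 * (Real.log n / n)) * (k * (n - k : ℕ)))
  have hz1 (z : Labels n) : 1 - B ≤ (configLaw p q z).real
      {ω | zhat n (graphOfPairs ω) = z ∨ zhat n (graphOfPairs ω) = -z} := by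
    have h := configLaw_real_fail_le p q z (fun ω => zhat n (graphOfPairs ω)) fun ω z' => by
      simpa only [likelihood_graphOfPairs] using hz n (graphOfPairs ω) z'
    have h' : ∑ k ∈ Finset.Ioo 0 n, (n.choose k : ℝ) * affinity p q ^ (k * (n - k)) ≤ B := by
      refine Finset.sum_le_sum fun k _ => mul_le_mul_of_nonneg_left ?_ (Nat.cast_nonneg _)
      refine (pow_le_pow_left₀ (affinity_nonneg _ _) haff _).trans ?_
      rw [← Real.exp_nat_mul]
      push_cast
      rw [mul_comm]
    have hcompl := probReal_compl_eq_one_sub (μ := configLaw p q z)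
      (Set.toFinite {ω | zhat n (graphOfPairs ω) = z ∨ zhat n (graphOfPairs ω) = -z}).measurableSet
    rw [Set.compl_ofPred] at hcompl
    linarith
  calc 1 - B = ∑ z : Labels n, (2 ^ n)⁻¹ * (1 - B) := by
        simp
    _ ≤ _ := Finset.sum_le_sum fun z _ => mul_le_mul_of_nonneg_left (hz1 z) (by positivity)

/-- A maximum-likelihood estimator exists. -/
lemma exists_isMLE (d : ℕ) (a b σ : ℝ) : ∃ zhat : Estimator, IsMLE d a b σ zhat := by
  have h (n : ℕ) (G : SimpleGraph (Fin n)) := Finite.exists_max fun z => likelihood n d a b σ z G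
  choose zhat hz using h
  exact ⟨zhat, hz⟩

/-! ### The pairs at a vertex -/

/-- The unordered pair `{i, j}`. -/
def pairOf {n : ℕ} (i : Fin n) (j : {j : Fin n // j ≠ i}) : VertexPair n :=
  ⟨(min i j, max i j), min_lt_max.2 j.2.symm⟩

lemma pairOf_injective {n : ℕ} (i : Fin n) : Function.Injective (pairOf i) := by
  rintro ⟨j, hj⟩ ⟨j', hj'⟩ h
  have h1 : min i j = min i j' := congrArg (fun e : VertexPair n => e.1.1) h
  have h2 : max i j = max i j' := congrArg (fun e : VertexPair n => e.1.2) h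
  ext
  rcases lt_or_gt_of_ne hj with h3 | h3 <;> rcases lt_or_gt_of_ne hj' with h4 | h4 <;>
    simp_all [min_eq_left_of_lt, min_eq_right_of_lt, max_eq_left_of_lt, max_eq_right_of_lt]

lemma graphOfPairs_adj_pairOf {n : ℕ} (ω : VertexPair n → Bool) (i : Fin n)
    (j : {j : Fin n // j ≠ i}) : (graphOfPairs ω).Adj i j ↔ ω (pairOf i j) = true := by
  obtain ⟨j, hj⟩ := j
  rcases lt_or_gt_of_ne hj with h | h
  · rw [SimpleGraph.adj_comm, graphOfPairs_adj ω h]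
    simp only [pairOf, min_eq_right_of_lt h, max_eq_left_of_lt h]
  · rw [graphOfPairs_adj ω h]
    simp only [pairOf, min_eq_left_of_lt h, max_eq_right_of_lt h]

lemma blockProb_pairOf {n : ℕ} (p q : unitInterval) (z : Labels n) (i : Fin n)
    (j : {j : Fin n // j ≠ i}) :
    blockProb p q z (pairOf i j).1.1 (pairOf i j).1.2 = blockProb p q z i j := by
  obtain ⟨j, hj⟩ := j
  rcases lt_or_gt_of_ne hj with h | h
  · simp only [pairOf, min_eq_right_of_lt h, max_eq_left_of_lt h, blockProb, eq_comm]
  · simp only [pairOf, min_eq_left_of_lt h, max_eq_right_of_lt h]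

/-- The pairs that contain the vertex `i`. -/
def incidentPairs {n : ℕ} (i : Fin n) : Finset (VertexPair n) := Finset.univ.image (pairOf i)

lemma mem_incidentPairs {n : ℕ} {i : Fin n} {e : VertexPair n} :
    e ∈ incidentPairs i ↔ e.1.1 = i ∨ e.1.2 = i := by
  simp only [incidentPairs, Finset.mem_image, Finset.mem_univ, true_and]
  constructor
  · rintro ⟨⟨j, hj⟩, rfl⟩
    rcases lt_or_gt_of_ne hj with h | h
    · right; simp only [pairOf, max_eq_left_of_lt h]
    · left; simp only [pairOf, min_eq_left_of_lt h]
  · obtain ⟨⟨u, v⟩, huv⟩ := e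
    simp only at huv ⊢
    rintro (rfl | rfl)
    · exact ⟨⟨v, huv.ne'⟩, by simp [pairOf, huv.le]⟩
    · exact ⟨⟨u, huv.ne⟩, by simp [pairOf, huv.le]⟩

lemma pairOf_mem_incidentPairs {n : ℕ} (i : Fin n) (j : {j : Fin n // j ≠ i}) :
    pairOf i j ∈ incidentPairs i := Finset.mem_image_of_mem _ (Finset.mem_univ j)

lemma prod_incidentPairs {n : ℕ} (i : Fin n) (f : VertexPair n → ℝ) :
    ∏ e ∈ incidentPairs i, f e = ∏ j : {j : Fin n // j ≠ i}, f (pairOf i j) :=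
  Finset.prod_image fun _ _ _ _ h => pairOf_injective i h

/-! ### Neighbourhood counts -/

/-- The other vertices of the community of `i`. -/
def mates {n : ℕ} (z : Labels n) (i : Fin n) : Finset (Fin n) := {j | j ≠ i ∧ z j = z i}

/-- The vertices of the community opposite to `i`. -/
def rivals {n : ℕ} (z : Labels n) (i : Fin n) : Finset (Fin n) := {j | j ≠ i ∧ z j ≠ z i}

open scoped Classical in
/-- The neighbours of `i` in the set `A`. -/
noncomputable def nbrsIn {n : ℕ} (ω : VertexPair n → Bool) (i : Fin n) (A : Finset (Fin n)) :
    Finset (Fin n) :=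
  {j ∈ A | (graphOfPairs ω).Adj i j}

open scoped Classical in
lemma nbrsIn_subset {n : ℕ} (ω : VertexPair n → Bool) (i : Fin n) (A : Finset (Fin n)) :
    nbrsIn ω i A ⊆ A := Finset.filter_subset _ _

open scoped Classical in
lemma nbrsIn_congr {n : ℕ} {ω ω' : VertexPair n → Bool} {i : Fin n}
    (h : ∀ e ∈ incidentPairs i, ω e = ω' e) (A : Finset (Fin n)) :
    nbrsIn ω i A = nbrsIn ω' i A := by
  unfold nbrsIn
  refine Finset.filter_congr fun j _ => ?_
  by_cases hj : j = i
  · subst hj; simp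
  · rw [graphOfPairs_adj_pairOf ω i ⟨j, hj⟩, graphOfPairs_adj_pairOf ω' i ⟨j, hj⟩,
      h _ (pairOf_mem_incidentPairs _ _)]

/-- The likelihood of a vertex with `m` potential neighbours of which `k` are present. -/
noncomputable def countWeight (u : ℝ) (m k : ℕ) : ℝ := u ^ k * (1 - u) ^ (m - k)

lemma prod_bernoulliWeight_pairOf {n : ℕ} (z : Labels n) (ω : VertexPair n → Bool) (i : Fin n)
    (u v : ℝ) :
    ∏ j : {j : Fin n // j ≠ i}, bernoulliWeight (if z i = z j then u else v) (ω (pairOf i j)) =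
      countWeight u (mates z i).card (nbrsIn ω i (mates z i)).card *
        countWeight v (rivals z i).card (nbrsIn ω i (rivals z i)).card := by
  classical
  let F : Fin n → ℝ := fun j =>
    bernoulliWeight (if z i = z j then u else v) (decide ((graphOfPairs ω).Adj i j))
  have hF (j : {j : Fin n // j ≠ i}) :
      bernoulliWeight (if z i = z j then u else v) (ω (pairOf i j)) = F j := by
    simp only [F]
    congr 1
    rw [Bool.eq_iff_iff, decide_eq_true_iff, graphOfPairs_adj_pairOf]
  have hcount (A : Finset (Fin n)) (w : ℝ)
      (hA : ∀ j ∈ A, (if z i = z j then u else v) = w) :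
      ∏ j ∈ A, F j = countWeight w A.card (nbrsIn ω i A).card := by
    have h1 : ∏ j ∈ A, F j = ∏ j ∈ A, if (graphOfPairs ω).Adj i j then w else 1 - w := by
      refine Finset.prod_congr rfl fun j hj => ?_
      simp only [F, hA j hj, bernoulliWeight, decide_eq_true_eq]
    have h2 := Finset.card_filter_add_card_filter_not (s := A) fun j => (graphOfPairs ω).Adj i j
    rw [h1, Finset.prod_ite, Finset.prod_const, Finset.prod_const, countWeight]
    have h3 : (nbrsIn ω i A).card = (A.filter fun j => (graphOfPairs ω).Adj i j).card := by
      unfold nbrsIn; congr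
    rw [h3]
    congr 2
    omega
  rw [Finset.prod_congr rfl fun j _ => hF j]
  have h1 : ∏ j : {j : Fin n // j ≠ i}, F j = ∏ j with j ≠ i, F j :=
    (Finset.prod_subtype _ (by simp) F).symm
  have h2 : (Finset.univ.filter fun j => j ≠ i) = mates z i ∪ rivals z i := by
    ext j; simp only [mates, rivals, Finset.mem_union, Finset.mem_filter, Finset.mem_univ, true_and]
    tauto
  have h3 : Disjoint (mates z i) (rivals z i) := by
    rw [Finset.disjoint_left]
    intro j; simp only [mates, rivals, Finset.mem_filter, Finset.mem_univ, true_and]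
    tauto
  rw [h1, h2, Finset.prod_union h3, hcount _ u, hcount _ v]
  · intro j hj
    have : z j ≠ z i := by simp [rivals] at hj; exact hj.2
    rw [if_neg this.symm]
  · intro j hj
    have : z j = z i := by simp [mates] at hj; exact hj.2
    rw [if_pos this.symm]

/-- The likelihood of the pairs that do not contain `i`. -/
noncomputable def restWeight {n : ℕ} (p q : unitInterval) (z : Labels n) (i : Fin n)
    (ω : VertexPair n → Bool) : ℝ :=
  ∏ e ∈ (incidentPairs i)ᶜ, bernoulliWeight (blockProb p q z e.1.1 e.1.2) (ω e)

lemma restWeight_nonneg {n : ℕ} (p q : unitInterval) (z : Labels n) (i : Fin n)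
    (ω : VertexPair n → Bool) : 0 ≤ restWeight p q z i ω :=
  Finset.prod_nonneg fun _ _ => bernoulliWeight_nonneg _ _

lemma coe_blockProb {n : ℕ} (p q : unitInterval) (z : Labels n) (i j : Fin n) :
    (blockProb p q z i j : ℝ) = if z i = z j then (p : ℝ) else q := by
  unfold blockProb; split_ifs <;> rfl

lemma weight_eq {n : ℕ} (p q : unitInterval) (z : Labels n) (i : Fin n)
    (ω : VertexPair n → Bool) :
    weight p q z ω = countWeight p (mates z i).card (nbrsIn ω i (mates z i)).card *
        countWeight q (rivals z i).card (nbrsIn ω i (rivals z i)).card * restWeight p q z i ω := by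
  rw [weight, ← Finset.prod_mul_prod_compl (incidentPairs i), restWeight, prod_incidentPairs]
  congr 1
  rw [← prod_bernoulliWeight_pairOf]
  exact Finset.prod_congr rfl fun j _ => by rw [blockProb_pairOf, coe_blockProb]

/-- The labels `z` with the label of `i` negated. -/
def flipAt {n : ℕ} (z : Labels n) (i : Fin n) : Labels n := Function.update z i (-z i)

lemma flipAt_injective {n : ℕ} (z : Labels n) : Function.Injective (flipAt z) := by
  intro i j h
  by_contra hij
  have := congrFun h i
  simp only [flipAt, Function.update_self, Function.update_of_ne hij] at this
  rcases Int.units_eq_one_or (z i) with h1 | h1 <;> rw [h1] at this <;> simp at this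

lemma mates_flipAt {n : ℕ} (z : Labels n) (i : Fin n) : mates (flipAt z i) i = rivals z i := by
  ext j
  simp only [mates, rivals, Finset.mem_filter, Finset.mem_univ, true_and]
  refine and_congr_right fun hj => ?_
  rw [flipAt, Function.update_self, Function.update_of_ne hj, units_eq_neg_iff]

lemma rivals_flipAt {n : ℕ} (z : Labels n) (i : Fin n) : rivals (flipAt z i) i = mates z i := by
  ext j
  simp only [mates, rivals, Finset.mem_filter, Finset.mem_univ, true_and]
  refine and_congr_right fun hj => ?_
  rw [flipAt, Function.update_self, Function.update_of_ne hj, Ne, units_eq_neg_iff, not_not]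

lemma restWeight_flipAt {n : ℕ} (p q : unitInterval) (z : Labels n) (i : Fin n)
    (ω : VertexPair n → Bool) : restWeight p q (flipAt z i) i ω = restWeight p q z i ω := by
  refine Finset.prod_congr rfl fun e he => ?_
  rw [Finset.mem_compl, mem_incidentPairs, not_or] at he
  simp only [blockProb, flipAt, Function.update_of_ne he.1, Function.update_of_ne he.2]

/-- The vertex `i` has exactly `k` neighbours in each community. -/
def tiedAt {n : ℕ} (z : Labels n) (k : ℕ) (i : Fin n) : Set (VertexPair n → Bool) :=
  {ω | (nbrsIn ω i (mates z i)).card = k ∧ (nbrsIn ω i (rivals z i)).card = k}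

/-- After cancelling the common powers, Bernoulli's inequality gives `(1 - v) ^ (A - B) ≥ 1/2`,
while `(1 - u) ^ (A - B) ≤ 1`. -/
lemma pow_le_two_mul_pow {u v : ℝ} (hu : 0 ≤ u) (hu' : u ≤ 1) (hv' : v ≤ 1) {A B : ℕ}
    (hAB : B ≤ A) (h : ((A : ℝ) - B) * v ≤ 1 / 2) :
    (1 - u) ^ A * (1 - v) ^ B ≤ 2 * ((1 - v) ^ A * (1 - u) ^ B) := by
  obtain ⟨d, rfl⟩ := Nat.exists_eq_add_of_le hAB
  push_cast at h
  have h1 : (1 - u) ^ d ≤ 1 := pow_le_one₀ (by linarith) (by linarith)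
  have h2 := one_add_mul_le_pow (a := -v) (by linarith) d
  rw [← sub_eq_add_neg] at h2
  have h3 : (1 - u) ^ d ≤ 2 * (1 - v) ^ d := by nlinarith
  have h4 : 0 ≤ (1 - u) ^ B * (1 - v) ^ B :=
    mul_nonneg (pow_nonneg (by linarith) _) (pow_nonneg (by linarith) _)
  rw [pow_add, pow_add]
  nlinarith [mul_le_mul_of_nonneg_left h3 h4]

/-- At a tie the present edges contribute `p ^ k * q ^ k` before and after the flip. Only the absent
edges differ, and their exponents are swapped, so the cost depends on the imbalance alone. -/
lemma weight_le_two_mul_weight_flipAt {n : ℕ} {p q : unitInterval} {z : Labels n} {k : ℕ}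
    {i : Fin n} {ω : VertexPair n → Bool} (hω : ω ∈ tiedAt z k i)
    (hp : |((mates z i).card : ℝ) - (rivals z i).card| * p ≤ 1 / 2)
    (hq : |((mates z i).card : ℝ) - (rivals z i).card| * q ≤ 1 / 2) :
    weight p q z ω ≤ 2 * weight p q (flipAt z i) ω := by
  rw [weight_eq p q z i, weight_eq p q (flipAt z i) i, mates_flipAt, rivals_flipAt,
    restWeight_flipAt, hω.1, hω.2]
  rw [← mul_assoc]
  refine mul_le_mul_of_nonneg_right ?_ (restWeight_nonneg _ _ _ _ _)
  have hk1 : k ≤ (mates z i).card := hω.1 ▸ Finset.card_le_card (nbrsIn_subset _ _ _)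
  have hk2 : k ≤ (rivals z i).card := hω.2 ▸ Finset.card_le_card (nbrsIn_subset _ _ _)
  obtain ⟨A, hA⟩ := Nat.exists_eq_add_of_le hk1
  obtain ⟨B, hB⟩ := Nat.exists_eq_add_of_le hk2
  rw [hA, hB] at hp hq ⊢
  push_cast at hp hq
  rw [add_sub_add_left_eq_sub] at hp hq
  simp only [countWeight, Nat.add_sub_cancel_left]
  have key : (1 - p : ℝ) ^ A * (1 - q) ^ B ≤ 2 * ((1 - q) ^ A * (1 - p) ^ B) := by
    rcases le_total B A with h | h
    · have h' : (B : ℝ) ≤ A := by exact_mod_cast h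
      rw [abs_of_nonneg (sub_nonneg.2 h')] at hq
      exact pow_le_two_mul_pow p.2.1 p.2.2 q.2.2 h hq
    · have h' : (A : ℝ) ≤ B := by exact_mod_cast h
      rw [abs_sub_comm, abs_of_nonneg (sub_nonneg.2 h')] at hp
      have := pow_le_two_mul_pow q.2.1 q.2.2 p.2.2 h hp
      linarith [mul_comm ((1 - p : ℝ) ^ A) ((1 - q) ^ B), mul_comm ((1 - q : ℝ) ^ A) ((1 - p) ^ B)]
  have h0 : 0 ≤ (p : ℝ) ^ k * (q : ℝ) ^ k := mul_nonneg (pow_nonneg p.2.1 _) (pow_nonneg q.2.1 _)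
  nlinarith [mul_le_mul_of_nonneg_left key h0]

/-! ### The probability of a tie at one vertex -/

lemma configLaw_real_cylinder {n : ℕ} (p q : unitInterval) (z : Labels n)
    (S : Finset (VertexPair n)) (ω₀ : VertexPair n → Bool) :
    (configLaw p q z).real {ω | ∀ e ∈ S, ω e = ω₀ e} =
      ∏ e ∈ S, bernoulliWeight (blockProb p q z e.1.1 e.1.2) (ω₀ e) := by
  classical
  have h : {ω : VertexPair n → Bool | ∀ e ∈ S, ω e = ω₀ e} =
      Set.univ.pi fun e => if e ∈ S then {ω₀ e} else Set.univ := by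
    ext ω
    simp only [Set.mem_ofPred_eq, Set.mem_univ_pi]
    refine forall_congr' fun e => ?_
    by_cases he : e ∈ S <;> simp [he]
  rw [h, measureReal_def, configLaw, Measure.pi_pi, ENNReal.toReal_prod,
    ← Finset.prod_subset (Finset.subset_univ S)]
  · refine Finset.prod_congr rfl fun e he => ?_
    rw [if_pos he, ← bernoulliMeasure_real_singleton, measureReal_def]
  · intro e _ he
    simp [he]

/-- Edge indicators for which the neighbourhood of `i` is `T`. -/
def starConfig {n : ℕ} (i : Fin n) (T : Finset (Fin n)) : VertexPair n → Bool :=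
  fun e => if e.1.1 = i then e.1.2 ∈ T else e.1.1 ∈ T

lemma starConfig_pairOf {n : ℕ} (i : Fin n) (T : Finset (Fin n)) (j : {j : Fin n // j ≠ i}) :
    starConfig i T (pairOf i j) = true ↔ (j : Fin n) ∈ T := by
  obtain ⟨j, hj⟩ := j
  rcases lt_or_gt_of_ne hj with h | h
  · simp [starConfig, pairOf, min_eq_right_of_lt h, max_eq_left_of_lt h, hj]
  · simp [starConfig, pairOf, min_eq_left_of_lt h, max_eq_right_of_lt h]

lemma nbrsIn_starConfig {n : ℕ} (i : Fin n) (T A : Finset (Fin n)) (hi : i ∉ T) :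
    nbrsIn (starConfig i T) i A = A ∩ T := by
  ext j
  simp only [nbrsIn, Finset.mem_filter, Finset.mem_inter]
  refine and_congr_right fun _ => ?_
  by_cases hj : j = i
  · subst hj; simp [hi]
  · rw [graphOfPairs_adj_pairOf _ i ⟨j, hj⟩, starConfig_pairOf]

/-- The tie event contains one cylinder for each choice of `k` neighbours in either community. These
cylinders are disjoint and equally likely. -/
lemma le_configLaw_real_tiedAt {n : ℕ} (p q : unitInterval) (z : Labels n) (k : ℕ) (i : Fin n) :
    ((mates z i).card.choose k * (rivals z i).card.choose k : ℝ) *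
      (countWeight p (mates z i).card k * countWeight q (rivals z i).card k) ≤
    (configLaw p q z).real (tiedAt z k i) := by
  classical
  set I := (mates z i).powersetCard k ×ˢ (rivals z i).powersetCard k
  -- Only pairs at `i` are prescribed, so the arbitrary values of `starConfig` elsewhere play no
  -- role.
  let C : Finset (Fin n) × Finset (Fin n) → Set (VertexPair n → Bool) := fun x =>
    {ω | ∀ e ∈ incidentPairs i, ω e = starConfig i (x.1 ∪ x.2) e}
  have hdisj : Disjoint (mates z i) (rivals z i) := by
    rw [Finset.disjoint_left]
    intro j; simp only [mates, rivals, Finset.mem_filter, Finset.mem_univ, true_and]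
    tauto
  have hI : ∀ x ∈ I, nbrsIn (starConfig i (x.1 ∪ x.2)) i (mates z i) = x.1 ∧
      nbrsIn (starConfig i (x.1 ∪ x.2)) i (rivals z i) = x.2 ∧ x.1.card = k ∧ x.2.card = k := by
    rintro ⟨A, B⟩ hx
    obtain ⟨⟨hA, hA'⟩, hB, hB'⟩ : (A ⊆ mates z i ∧ A.card = k) ∧ B ⊆ rivals z i ∧ B.card = k := by
      simpa [I, Finset.mem_product, Finset.mem_powersetCard] using hx
    have hi : i ∉ A ∪ B := by
      rw [Finset.mem_union, not_or]
      exact ⟨fun h => by simpa [mates] using hA h, fun h => by simpa [rivals] using hB h⟩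
    refine ⟨?_, ?_, hA', hB'⟩
    · rw [nbrsIn_starConfig _ _ _ hi, Finset.inter_union_distrib_left,
        Finset.inter_eq_right.2 hA, Finset.disjoint_iff_inter_eq_empty.1
          (hdisj.mono_right hB), Finset.union_empty]
    · rw [nbrsIn_starConfig _ _ _ hi, Finset.inter_union_distrib_left,
        Finset.inter_eq_right.2 hB, Finset.disjoint_iff_inter_eq_empty.1
          (hdisj.symm.mono_right hA), Finset.empty_union]
  have hsub : (⋃ x ∈ I, C x) ⊆ tiedAt z k i := by
    intro ω hω
    obtain ⟨x, hx, hωx⟩ : ∃ x ∈ I, ω ∈ C x := by simpa using hω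
    obtain ⟨h1, h2, h3, h4⟩ := hI x hx
    refine ⟨?_, ?_⟩
    · rw [nbrsIn_congr hωx, h1, h3]
    · rw [nbrsIn_congr hωx, h2, h4]
  have hpd : (I : Set (Finset (Fin n) × Finset (Fin n))).PairwiseDisjoint C := by
    intro x hx y hy hxy
    refine Set.disjoint_left.2 fun ω hωx hωy => hxy ?_
    obtain ⟨h1, h2, -, -⟩ := hI x hx
    obtain ⟨h3, h4, -, -⟩ := hI y hy
    rw [← nbrsIn_congr hωx] at h1 h2
    rw [← nbrsIn_congr hωy] at h3 h4
    exact Prod.ext (h1.symm.trans h3) (h2.symm.trans h4)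
  have hC : ∀ x ∈ I, (configLaw p q z).real (C x) =
      countWeight p (mates z i).card k * countWeight q (rivals z i).card k := by
    intro x hx
    obtain ⟨h1, h2, h3, h4⟩ := hI x hx
    rw [configLaw_real_cylinder, prod_incidentPairs]
    simp only [blockProb_pairOf, coe_blockProb]
    rw [prod_bernoulliWeight_pairOf, h1, h2, h3, h4]
  refine le_trans (le_of_eq ?_) (measureReal_mono hsub)
  rw [measureReal_biUnion_finset hpd fun x _ => (Set.toFinite _).measurableSet,
    Finset.sum_congr rfl hC, Finset.sum_const, Finset.card_product, Finset.card_powersetCard,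
    Finset.card_powersetCard, nsmul_eq_mul]
  push_cast
  ring

/-! ### Ties at two vertices -/

lemma configLaw_real_inter {n : ℕ} (p q : unitInterval) (z : Labels n)
    {S T : Finset (VertexPair n)} (hST : Disjoint S T) {A B : Set (VertexPair n → Bool)}
    (hA : ∀ ω ω', (∀ e ∈ S, ω e = ω' e) → ω ∈ A → ω' ∈ A)
    (hB : ∀ ω ω', (∀ e ∈ T, ω e = ω' e) → ω ∈ B → ω' ∈ B) :
    (configLaw p q z).real (A ∩ B) = (configLaw p q z).real A * (configLaw p q z).real B := by
  have hind : iIndepFun (fun e (ω : VertexPair n → Bool) => ω e) (configLaw p q z) :=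
    iIndepFun_pi (X := fun _ x => x) fun e => aemeasurable_id
  have h := hind.indepFun_finset S T hST fun e => measurable_pi_apply e
  have hpre (S : Finset (VertexPair n)) (A : Set (VertexPair n → Bool))
      (hA : ∀ ω ω', (∀ e ∈ S, ω e = ω' e) → ω ∈ A → ω' ∈ A) :
      (fun (ω : VertexPair n → Bool) (e : S) => ω e) ⁻¹'
        ((fun (ω : VertexPair n → Bool) (e : S) => ω e) '' A) = A := by
    refine Set.Subset.antisymm ?_ (Set.subset_preimage_image _ _)
    rintro ω ⟨ω', hω', heq⟩
    exact hA ω' ω (fun e he => congrFun heq ⟨e, he⟩) hω'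
  have h2 := h.measure_inter_preimage_eq_mul _ _
    (Set.toFinite ((fun (ω : VertexPair n → Bool) (e : S) => ω e) '' A)).measurableSet
    (Set.toFinite ((fun (ω : VertexPair n → Bool) (e : T) => ω e) '' B)).measurableSet
  rw [hpre S A hA, hpre T B hB] at h2
  simp only [measureReal_def, h2, ENNReal.toReal_mul]

lemma tiedAt_congr {n : ℕ} {z : Labels n} {k : ℕ} {i : Fin n} {ω ω' : VertexPair n → Bool}
    (h : ∀ e ∈ incidentPairs i, ω e = ω' e) (hω : ω ∈ tiedAt z k i) : ω' ∈ tiedAt z k i := by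
  simpa only [tiedAt, Set.mem_ofPred_eq, nbrsIn_congr h] using hω

/-- Ties at `i` and `j` share only the pair `{i, j}`. Once it is known to be absent they are
independent, and its absence has probability at least `1 - t`. -/
lemma mul_configLaw_real_tiedAt_inter_le {n : ℕ} {p q : unitInterval} (z : Labels n) (k : ℕ)
    {i j : Fin n} (hij : j ≠ i) {t : ℝ} (hp : (p : ℝ) ≤ t) (hq : (q : ℝ) ≤ t) :
    (1 - t) * (configLaw p q z).real
        (tiedAt z k i ∩ tiedAt z k j ∩ {ω | ¬ (graphOfPairs ω).Adj i j}) ≤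
      (configLaw p q z).real (tiedAt z k i) * (configLaw p q z).real (tiedAt z k j) := by
  classical
  set μ := configLaw p q z
  set e₀ := pairOf i ⟨j, hij⟩
  set F : Set (VertexPair n → Bool) := {ω | ω e₀ = false}
  have hF : {ω | ¬ (graphOfPairs ω).Adj i j} = F := by
    ext ω
    simp only [F, Set.mem_ofPred_eq]
    rw [graphOfPairs_adj_pairOf ω i ⟨j, hij⟩, Bool.not_eq_true]
  -- Forcing `e₀` off makes the tie at `i` independent of all pairs at `j`, without changing it on
  -- `F`.
  set E₀ : Set (VertexPair n → Bool) := {ω | Function.update ω e₀ false ∈ tiedAt z k i}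
  have hup (ω : VertexPair n → Bool) (h : ω ∈ F) : Function.update ω e₀ false = ω := by
    rw [← show ω e₀ = false from h, Function.update_eq_self]
  have hEF : tiedAt z k i ∩ F = E₀ ∩ F := by
    ext ω
    refine and_congr_left fun h => ?_
    simp only [E₀, Set.mem_ofPred_eq, hup ω h]
  have hE₀ : ∀ ω ω', (∀ e ∈ (incidentPairs i).erase e₀, ω e = ω' e) → ω ∈ E₀ → ω' ∈ E₀ := by
    intro ω ω' h hω
    refine tiedAt_congr (fun e he => ?_) hω
    by_cases hee : e = e₀
    · subst hee; simp
    · rw [Function.update_of_ne hee, Function.update_of_ne hee,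
        h e (Finset.mem_erase.2 ⟨hee, he⟩)]
  have he₀ : e₀ ∈ incidentPairs j := by
    rw [mem_incidentPairs]
    rcases lt_or_gt_of_ne hij with h | h
    · left; simp only [e₀, pairOf, min_eq_right_of_lt h]
    · right; simp only [e₀, pairOf, max_eq_right_of_lt h]
  have hdisj : Disjoint ((incidentPairs i).erase e₀) (incidentPairs j) := by
    rw [Finset.disjoint_left]
    intro e he hej
    rw [Finset.mem_erase] at he
    refine he.1 ?_
    obtain ⟨x, -, hx⟩ := Finset.mem_image.1 he.2
    have hx' : (x : Fin n) = j := by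
      rw [mem_incidentPairs, ← hx] at hej
      rcases lt_or_gt_of_ne x.2 with h | h
      · simp only [pairOf, min_eq_right_of_lt h, max_eq_left_of_lt h] at hej
        exact hej.resolve_right hij.symm
      · simp only [pairOf, min_eq_left_of_lt h, max_eq_right_of_lt h] at hej
        exact hej.resolve_left hij.symm
    rw [← hx]
    exact congrArg (pairOf i) (Subtype.ext hx')
  have hFj : ∀ ω ω', (∀ e ∈ incidentPairs j, ω e = ω' e) → ω ∈ F → ω' ∈ F :=
    fun ω ω' h hω => (h e₀ he₀).symm.trans hω
  have h1 : μ.real (E₀ ∩ F) = μ.real E₀ * μ.real F := configLaw_real_inter p q z hdisj hE₀ hFj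
  have h2 : μ.real (E₀ ∩ (tiedAt z k j ∩ F)) = μ.real E₀ * μ.real (tiedAt z k j ∩ F) :=
    configLaw_real_inter p q z hdisj hE₀ fun ω ω' h hω =>
      ⟨tiedAt_congr h hω.1, hFj ω ω' h hω.2⟩
  have h3 : 1 - t ≤ μ.real F := by
    have : F = {ω | ∀ e ∈ ({e₀} : Finset _), ω e = (fun _ => false) e} := by
      ext; simp [F]
    rw [this, configLaw_real_cylinder, Finset.prod_singleton]
    simp only [bernoulliWeight, coe_blockProb, Bool.false_eq_true, if_false]
    split_ifs <;> linarith
  have h4 : tiedAt z k i ∩ tiedAt z k j ∩ F = E₀ ∩ (tiedAt z k j ∩ F) := by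
    rw [Set.inter_right_comm, hEF, Set.inter_assoc, Set.inter_comm F]
  rw [hF, h4, h2]
  have h5 : μ.real (E₀ ∩ F) ≤ μ.real (tiedAt z k i) :=
    hEF ▸ measureReal_mono Set.inter_subset_left
  have h6 : μ.real (tiedAt z k j ∩ F) ≤ μ.real (tiedAt z k j) :=
    measureReal_mono Set.inter_subset_left
  calc (1 - t) * (μ.real E₀ * μ.real (tiedAt z k j ∩ F))
      ≤ μ.real F * (μ.real E₀ * μ.real (tiedAt z k j ∩ F)) :=
        mul_le_mul_of_nonneg_right h3 (by positivity)
    _ = μ.real (E₀ ∩ F) * μ.real (tiedAt z k j ∩ F) := by rw [h1]; ring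
    _ ≤ _ := mul_le_mul h5 h6 (by positivity) (by positivity)

/-! ### The number of ties -/

open scoped Classical in
/-- The number of vertices with exactly `k` neighbours in each community. -/
noncomputable def tiedCount {n : ℕ} (z : Labels n) (k : ℕ) (ω : VertexPair n → Bool) : ℕ :=
  (Finset.univ.filter fun i => ω ∈ tiedAt z k i).card

open scoped Classical in
lemma sum_weight_mul_ite {n : ℕ} (p q : unitInterval) (z : Labels n)
    (S : Set (VertexPair n → Bool)) :
    ∑ ω, weight p q z ω * (if ω ∈ S then 1 else 0) = (configLaw p q z).real S := by
  rw [configLaw_real_apply, Finset.sum_filter]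
  exact Finset.sum_congr rfl fun ω _ => by simp

open scoped Classical in
lemma tiedCount_eq {n : ℕ} (z : Labels n) (k : ℕ) (ω : VertexPair n → Bool) :
    (tiedCount z k ω : ℝ) = ∑ i, if ω ∈ tiedAt z k i then 1 else 0 := by
  simp [tiedCount]

lemma sum_weight_mul_tiedCount {n : ℕ} (p q : unitInterval) (z : Labels n) (k : ℕ) :
    ∑ ω, weight p q z ω * tiedCount z k ω = ∑ i, (configLaw p q z).real (tiedAt z k i) := by
  classical
  simp_rw [tiedCount_eq, Finset.mul_sum]
  rw [Finset.sum_comm]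
  exact Finset.sum_congr rfl fun i _ => by rw [← sum_weight_mul_ite]

lemma card_adj_of_mem_tiedAt {n : ℕ} {z : Labels n} {k : ℕ} {i : Fin n} {ω : VertexPair n → Bool}
    [DecidablePred ((graphOfPairs ω).Adj i)] (h : ω ∈ tiedAt z k i) :
    (Finset.univ.filter fun j => (graphOfPairs ω).Adj i j).card ≤ 2 * k := by
  classical
  have hsub : (Finset.univ.filter fun j => (graphOfPairs ω).Adj i j) ⊆
      nbrsIn ω i (mates z i) ∪ nbrsIn ω i (rivals z i) := by
    intro j hj
    have hj : (graphOfPairs ω).Adj i j := by simpa using hj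
    have hne : j ≠ i := hj.ne'
    simp only [nbrsIn, mates, rivals, Finset.mem_union, Finset.mem_filter, Finset.mem_univ,
      true_and]
    tauto
  refine (Finset.card_le_card hsub).trans ((Finset.card_union_le _ _).trans ?_)
  rw [h.1, h.2, two_mul]

-- In the sum over ordered pairs of tied vertices, the diagonal gives `tiedCount`. Adjacent pairs
-- give at most `2 * k * tiedCount`, because a tied vertex has degree at most `2 * k`. Only
-- non-adjacent pairs need decoupling.
open scoped Classical in
lemma tiedCount_sq_le {n : ℕ} (z : Labels n) (k : ℕ) (ω : VertexPair n → Bool) :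
    (tiedCount z k ω : ℝ) ^ 2 ≤ (1 + 2 * k) * tiedCount z k ω +
      ∑ i, ∑ j with j ≠ i,
        if ω ∈ tiedAt z k i ∩ tiedAt z k j ∩ {ω | ¬ (graphOfPairs ω).Adj i j} then 1 else 0 := by
  rw [sq]
  nth_rewrite 1 [tiedCount_eq]
  rw [Finset.sum_mul]
  nth_rewrite 2 [tiedCount_eq]
  rw [Finset.mul_sum, ← Finset.sum_add_distrib]
  refine Finset.sum_le_sum fun i _ => ?_
  by_cases hi : ω ∈ tiedAt z k i
  · simp only [hi, if_true, one_mul, mul_one, Set.mem_inter_iff, true_and, Set.mem_ofPred_eq]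
    rw [tiedCount_eq, ← Finset.add_sum_erase _ _ (Finset.mem_univ i)]
    have h1 : Finset.univ.erase i = Finset.univ.filter (· ≠ i) := by ext; simp
    have h2 : ∑ j with j ≠ i, (if ω ∈ tiedAt z k j then (1 : ℝ) else 0) ≤
        ∑ j with j ≠ i, ((if (graphOfPairs ω).Adj i j then 1 else 0) +
          if ω ∈ tiedAt z k j ∧ ¬ (graphOfPairs ω).Adj i j then 1 else 0) := by
      refine Finset.sum_le_sum fun j _ => ?_
      by_cases h3 : ω ∈ tiedAt z k j <;> by_cases h4 : (graphOfPairs ω).Adj i j <;> simp [h3, h4]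
    have h5 : ∑ j with j ≠ i, (if (graphOfPairs ω).Adj i j then (1 : ℝ) else 0) ≤ 2 * k := by
      refine (Finset.sum_le_sum_of_subset_of_nonneg (Finset.subset_univ _)
        fun _ _ _ => by split_ifs <;> simp).trans ?_
      rw [Finset.sum_boole]
      exact_mod_cast card_adj_of_mem_tiedAt hi
    rw [Finset.sum_add_distrib] at h2
    simp only [hi, if_true]
    rw [h1]
    linarith
  · simp [hi]

lemma sum_weight_mul_tiedCount_sq_le {n : ℕ} {p q : unitInterval} (z : Labels n) (k : ℕ) {t : ℝ}
    (hp : (p : ℝ) ≤ t) (hq : (q : ℝ) ≤ t) (ht : t < 1) :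
    ∑ ω, weight p q z ω * (tiedCount z k ω : ℝ) ^ 2 ≤
      (1 + 2 * k) * (∑ i, (configLaw p q z).real (tiedAt z k i)) +
        (∑ i, (configLaw p q z).real (tiedAt z k i)) ^ 2 / (1 - t) := by
  classical
  refine (Finset.sum_le_sum fun ω _ => mul_le_mul_of_nonneg_left (tiedCount_sq_le z k ω)
    (weight_nonneg p q z ω)).trans ?_
  simp_rw [mul_add, Finset.sum_add_distrib]
  refine add_le_add (le_of_eq ?_) ?_
  · rw [← sum_weight_mul_tiedCount, Finset.mul_sum]
    exact Finset.sum_congr rfl fun ω _ => by ring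
  · simp_rw [Finset.mul_sum]
    rw [Finset.sum_comm, sq, Finset.sum_mul, Finset.sum_div]
    refine Finset.sum_le_sum fun i _ => ?_
    rw [Finset.sum_comm, Finset.mul_sum, Finset.sum_div]
    refine (Finset.sum_le_sum fun j hj => ?_).trans
      (Finset.sum_le_sum_of_subset_of_nonneg (Finset.subset_univ _) fun j _ _ => ?_)
    · have h := sum_weight_mul_ite p q z
        (tiedAt z k i ∩ tiedAt z k j ∩ {ω | ¬ (graphOfPairs ω).Adj i j})
      refine (le_of_eq ((Finset.sum_congr rfl fun ω _ => by congr).trans h)).trans ?_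
      rw [le_div_iff₀ (sub_pos.2 ht), mul_comm]
      exact mul_configLaw_real_tiedAt_inter_le z k (by simpa using hj) hp hq
    · exact div_nonneg (by positivity) (sub_nonneg.2 ht.le)

/-- Chebyshev's inequality at half the mean `E`: the second-moment bound makes the variance at most
`(1 + 2 * k) * E + E ^ 2 * t / (1 - t)`. -/
lemma configLaw_real_tiedCount_lt_le {n : ℕ} {p q : unitInterval} (z : Labels n) (k : ℕ)
    {t m : ℝ} (hp : (p : ℝ) ≤ t) (hq : (q : ℝ) ≤ t) (ht : t < 1) (hm : 0 < m)
    (hmean : m ≤ ∑ i, (configLaw p q z).real (tiedAt z k i)) :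
    (configLaw p q z).real {ω | (tiedCount z k ω : ℝ) < m / 2} ≤
      4 * ((1 + 2 * k) / m + t / (1 - t)) := by
  classical
  set E := ∑ i, (configLaw p q z).real (tiedAt z k i)
  have hE : 0 < E := hm.trans_le hmean
  have h1 : (configLaw p q z).real {ω | (tiedCount z k ω : ℝ) < m / 2} * (E / 2) ^ 2 ≤
      ∑ ω, weight p q z ω * ((tiedCount z k ω : ℝ) - E) ^ 2 := by
    rw [← sum_weight_mul_ite, Finset.sum_mul]
    refine Finset.sum_le_sum fun ω _ => ?_
    rw [mul_assoc]
    refine mul_le_mul_of_nonneg_left ?_ (weight_nonneg p q z ω)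
    split_ifs with h
    · have h : (tiedCount z k ω : ℝ) < m / 2 := h
      nlinarith
    · rw [zero_mul]; positivity
  have h2 : ∑ ω, weight p q z ω * ((tiedCount z k ω : ℝ) - E) ^ 2 =
      ∑ ω, weight p q z ω * (tiedCount z k ω : ℝ) ^ 2 - E ^ 2 := by
    have h3 : ∀ ω, weight p q z ω * ((tiedCount z k ω : ℝ) - E) ^ 2 =
        weight p q z ω * (tiedCount z k ω : ℝ) ^ 2 -
          2 * E * (weight p q z ω * tiedCount z k ω) + E ^ 2 * weight p q z ω := fun ω => by ring
    simp_rw [h3]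
    rw [Finset.sum_add_distrib, Finset.sum_sub_distrib, ← Finset.mul_sum, ← Finset.mul_sum,
      sum_weight_mul_tiedCount, sum_weight]
    ring
  have h4 := sum_weight_mul_tiedCount_sq_le z k hp hq ht
  have ht' : 0 < 1 - t := sub_pos.2 ht
  have h5 : (configLaw p q z).real {ω | (tiedCount z k ω : ℝ) < m / 2} ≤
      4 * ((1 + 2 * k) / E + t / (1 - t)) := by
    rw [← mul_le_mul_iff_left₀ (by positivity : 0 < (E / 2) ^ 2)]
    have h6 : 4 * ((1 + 2 * k) / E + t / (1 - t)) * (E / 2) ^ 2 =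
        (1 + 2 * k) * E + E ^ 2 / (1 - t) - E ^ 2 := by
      field_simp
      ring
    rw [h6]
    linarith
  refine h5.trans ?_
  gcongr

/-! ### Failure of every estimator -/

/-- Flips at different tied vertices are different labelings, each with at least half the weight of
`z`. -/
lemma mul_weight_le_sum_weight {n : ℕ} {p q : unitInterval} {z : Labels n} {k : ℕ}
    {ω : VertexPair n → Bool}
    (hz : ∀ i, ω ∈ tiedAt z k i → weight p q z ω ≤ 2 * weight p q (flipAt z i) ω) :
    tiedCount z k ω * weight p q z ω ≤ 2 * ∑ z', weight p q z' ω := by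
  classical
  rw [tiedCount, ← nsmul_eq_mul, ← Finset.sum_const]
  calc _ ≤ ∑ i with ω ∈ tiedAt z k i, 2 * weight p q (flipAt z i) ω :=
        Finset.sum_le_sum fun i hi => hz i (by simpa using hi)
    _ = 2 * ∑ z' ∈ (Finset.univ.filter fun i => ω ∈ tiedAt z k i).image (flipAt z),
          weight p q z' ω := by
        rw [← Finset.mul_sum, Finset.sum_image fun _ _ _ _ h => flipAt_injective z h]
    _ ≤ _ := by
        refine mul_le_mul_of_nonneg_left ?_ zero_le_two
        exact Finset.sum_le_sum_of_subset_of_nonneg (Finset.subset_univ _)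
          fun _ _ _ => weight_nonneg _ _ _ _

/-- Labels outside `B` and configurations with fewer than `M` ties are given up. Elsewhere a correct
`z` has at most `2 / M` of the total weight at `ω`. Summing over the at most two labelings `±e ω`,
then over `ω`, gives `4 / M`, since each labeling has total weight `1`. -/
lemma sum_configLaw_real_success_le {n : ℕ} {p q : unitInterval} {k : ℕ} {M η : ℝ} (hM : 0 < M)
    (B : Finset (Labels n)) (e : (VertexPair n → Bool) → Labels n)
    (hflip : ∀ z ∈ B, ∀ ω i, ω ∈ tiedAt z k i → weight p q z ω ≤ 2 * weight p q (flipAt z i) ω)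
    (hfew : ∀ z ∈ B, (configLaw p q z).real {ω | (tiedCount z k ω : ℝ) < M} ≤ η) (hη : 0 ≤ η) :
    ∑ z : Labels n, (2 ^ n)⁻¹ * (configLaw p q z).real {ω | e ω = z ∨ e ω = -z} ≤
      (2 ^ n)⁻¹ * (Bᶜ.card : ℝ) + η + 4 / M := by
  classical
  have hpos (z : Labels n) : (configLaw p q z).real {ω | e ω = z ∨ e ω = -z} ≤
      (if z ∈ Bᶜ then 1 else 0) + η +
        ∑ ω, if e ω = z ∨ e ω = -z then 2 / M * ∑ z', weight p q z' ω else 0 := by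
    have hS : 0 ≤ ∑ ω, if e ω = z ∨ e ω = -z then 2 / M * ∑ z', weight p q z' ω else 0 := by
      refine Finset.sum_nonneg fun ω _ => ?_
      split_ifs
      · exact mul_nonneg (by positivity) (Finset.sum_nonneg fun _ _ => weight_nonneg _ _ _ _)
      · exact le_rfl
    by_cases hz : z ∈ B
    · have hsub : {ω | e ω = z ∨ e ω = -z} ⊆ {ω | (tiedCount z k ω : ℝ) < M} ∪
          {ω | (e ω = z ∨ e ω = -z) ∧ M ≤ (tiedCount z k ω : ℝ)} := by
        intro ω hω
        rcases lt_or_ge (tiedCount z k ω : ℝ) M with h | h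
        · exact Or.inl h
        · exact Or.inr ⟨hω, h⟩
      have h1 := (measureReal_mono (μ := configLaw p q z) hsub).trans (measureReal_union_le _ _)
      have h2 : (configLaw p q z).real
          {ω | (e ω = z ∨ e ω = -z) ∧ M ≤ (tiedCount z k ω : ℝ)} ≤
          ∑ ω, if e ω = z ∨ e ω = -z then 2 / M * ∑ z', weight p q z' ω else 0 := by
        rw [configLaw_real_apply, Finset.sum_filter]
        refine Finset.sum_le_sum fun ω _ => ?_
        simp only [Set.mem_ofPred_eq]
        by_cases h3 : e ω = z ∨ e ω = -z
        · simp only [h3, true_and, if_true]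
          split_ifs with h4
          · rw [div_mul_eq_mul_div, le_div_iff₀ hM, mul_comm]
            exact (mul_le_mul_of_nonneg_right h4 (weight_nonneg _ _ _ _)).trans
              (mul_weight_le_sum_weight (hflip z hz ω))
          · exact mul_nonneg (by positivity) (Finset.sum_nonneg fun _ _ => weight_nonneg _ _ _ _)
        · simp [h3]
      have h5 := hfew z hz
      have h6 : z ∉ Bᶜ := by simpa using hz
      rw [if_neg h6]
      linarith
    · have h6 : z ∈ Bᶜ := by simpa using hz
      rw [if_pos h6]
      have : (configLaw p q z).real {ω | e ω = z ∨ e ω = -z} ≤ 1 := measureReal_le_one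
      linarith
  rw [← Finset.mul_sum]
  have hsum := Finset.sum_le_sum fun z (_ : z ∈ (Finset.univ : Finset (Labels n))) => hpos z
  rw [Finset.sum_add_distrib, Finset.sum_add_distrib] at hsum
  have h1 : ∑ z : Labels n, (if z ∈ Bᶜ then (1 : ℝ) else 0) = Bᶜ.card := by
    rw [Finset.sum_boole, Finset.filter_univ_mem]
  have h2 : ∑ _z : Labels n, η = 2 ^ n * η := by simp
  have h3 : ∑ z : Labels n, ∑ ω, (if e ω = z ∨ e ω = -z then 2 / M * ∑ z', weight p q z' ω else 0)
      ≤ 4 / M * 2 ^ n := by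
    rw [Finset.sum_comm]
    have h4 (ω : VertexPair n → Bool) :
        ∑ z : Labels n, (if e ω = z ∨ e ω = -z then 2 / M * ∑ z', weight p q z' ω else 0) ≤
          4 / M * ∑ z', weight p q z' ω := by
      rw [← Finset.sum_filter, Finset.sum_const, nsmul_eq_mul]
      have hc : (Finset.univ.filter fun z => e ω = z ∨ e ω = -z).card ≤ 2 := by
        refine (Finset.card_le_card (t := {e ω, -e ω}) fun z hz => ?_).trans Finset.card_le_two
        have hz : e ω = z ∨ e ω = -z := by simpa using hz
        rw [Finset.mem_insert, Finset.mem_singleton]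
        rcases hz with h | h
        · exact Or.inl h.symm
        · exact Or.inr (by rw [h, neg_neg])
      have hw : 0 ≤ 2 / M * ∑ z', weight p q z' ω :=
        mul_nonneg (by positivity) (Finset.sum_nonneg fun _ _ => weight_nonneg _ _ _ _)
      calc _ ≤ 2 * (2 / M * ∑ z', weight p q z' ω) :=
            mul_le_mul_of_nonneg_right (by exact_mod_cast hc) hw
        _ = _ := by ring
    refine (Finset.sum_le_sum fun ω _ => h4 ω).trans (le_of_eq ?_)
    rw [← Finset.mul_sum, Finset.sum_comm]
    simp_rw [sum_weight]
    simp
  rw [h1, h2] at hsum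
  have h2n : (0 : ℝ) < 2 ^ n := by positivity
  calc _ ≤ (2 ^ n : ℝ)⁻¹ * ((Bᶜ.card : ℝ) + 2 ^ n * η + 4 / M * 2 ^ n) :=
        mul_le_mul_of_nonneg_left (by linarith) (by positivity)
    _ = _ := by field_simp

/-! ### Balanced labels -/

/-- The difference of the sizes of the two communities. -/
def imbalance {n : ℕ} (z : Labels n) : ℤ := ∑ i, (z i : ℤ)

lemma card_mates_add_card_rivals {n : ℕ} (z : Labels n) (i : Fin n) :
    (mates z i).card + (rivals z i).card + 1 = n := by
  have h1 := Finset.card_filter_add_card_filter_not (s := Finset.univ.filter fun j => j ≠ i)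
    fun j => z j = z i
  have h2 : (Finset.univ.filter fun j => j ≠ i).card = n - 1 := by
    have : (Finset.univ.filter fun j => j ≠ i) = Finset.univ.erase i := by ext; simp
    rw [this, Finset.card_erase_of_mem (Finset.mem_univ i), Finset.card_univ, Fintype.card_fin]
  rw [Finset.filter_filter, Finset.filter_filter, h2] at h1
  have : 0 < n := i.pos
  simp only [mates, rivals, ne_eq] at h1 ⊢
  omega

/-- The `+ 1` is the vertex `i` itself, which `mates` leaves out. -/
lemma mul_imbalance {n : ℕ} (z : Labels n) (i : Fin n) :
    (z i : ℤ) * imbalance z = (mates z i).card + 1 - (rivals z i).card := by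
  rw [imbalance, Finset.mul_sum, ← Finset.add_sum_erase _ _ (Finset.mem_univ i)]
  have h0 : (z i : ℤ) * z i = 1 := by
    rcases Int.units_eq_one_or (z i) with h | h <;> simp [h]
  have h1 : ∀ j ∈ Finset.univ.erase i,
      (z i : ℤ) * z j = (if z j = z i then 1 else 0) - if z j ≠ z i then 1 else 0 := by
    intro j _
    rcases Int.units_eq_one_or (z i) with h | h <;> rcases Int.units_eq_one_or (z j) with h' | h' <;>
      simp [h, h']
  have hm : mates z i = (Finset.univ.erase i).filter fun j => z j = z i := by
    ext; simp [mates]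
  have hr : rivals z i = (Finset.univ.erase i).filter fun j => z j ≠ z i := by
    ext; simp [rivals]
  rw [h0, Finset.sum_congr rfl h1, Finset.sum_sub_distrib, Finset.sum_boole, Finset.sum_boole, hm,
    hr]
  ring

lemma abs_card_mates_sub_card_rivals_le {n : ℕ} (z : Labels n) (i : Fin n) :
    |((mates z i).card : ℝ) - (rivals z i).card| ≤ |(imbalance z : ℝ)| + 1 := by
  have h : ((z i : ℤ) : ℝ) * imbalance z = (mates z i).card + 1 - (rivals z i).card := by
    exact_mod_cast mul_imbalance z i
  have h1 : |((z i : ℤ) : ℝ)| = 1 := by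
    rcases Int.units_eq_one_or (z i) with h | h <;> simp [h]
  have h2 : ((mates z i).card : ℝ) - (rivals z i).card = (z i : ℤ) * imbalance z - 1 := by
    rw [h]; ring
  rw [h2]
  refine (abs_sub _ _).trans ?_
  rw [abs_mul, h1, one_mul, abs_one]

lemma sum_imbalance_sq (n : ℕ) : ∑ z : Labels n, (imbalance z : ℝ) ^ 2 = n * 2 ^ n := by
  have h (z : Labels n) : (imbalance z : ℝ) ^ 2 = ∑ i, ∑ j, ((z i : ℤ) : ℝ) * (z j : ℤ) := by
    rw [imbalance, sq, Int.cast_sum, Finset.sum_mul_sum]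
  simp_rw [h]
  rw [Finset.sum_comm]
  have h1 (i : Fin n) : ∑ z : Labels n, ∑ j, ((z i : ℤ) : ℝ) * (z j : ℤ) = 2 ^ n := by
    rw [Finset.sum_comm, Finset.sum_eq_single i]
    · have (z : Labels n) : ((z i : ℤ) : ℝ) * (z i : ℤ) = 1 := by
        rcases Int.units_eq_one_or (z i) with h | h <;> simp [h]
      simp [this]
    · intro j _ hj
      have hinv : Function.Involutive fun z : Labels n => flipAt z i := fun z => by
        simp [flipAt]
      have h2 := Equiv.sum_comp hinv.toPerm fun z : Labels n => ((z i : ℤ) : ℝ) * (z j : ℤ)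
      simp only [Function.Involutive.coe_toPerm, flipAt, Function.update_self,
        Function.update_of_ne hj, Units.val_neg, Int.cast_neg, neg_mul,
        Finset.sum_neg_distrib] at h2
      linarith
    · simp
  simp [h1]

lemma card_imbalance_gt_le (n : ℕ) {w : ℝ} (hw : 0 < w) [DecidablePred fun z : Labels n =>
    ¬ |(imbalance z : ℝ)| ≤ w] :
    (2 ^ n)⁻¹ * ((Finset.univ.filter fun z : Labels n => ¬ |(imbalance z : ℝ)| ≤ w).card : ℝ) ≤
      n / w ^ 2 := by
  have h : ((Finset.univ.filter fun z : Labels n => ¬ |(imbalance z : ℝ)| ≤ w).card : ℝ) * w ^ 2 ≤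
      n * 2 ^ n := by
    rw [← sum_imbalance_sq, ← nsmul_eq_mul, ← Finset.sum_const]
    refine (Finset.sum_le_sum fun z hz => ?_).trans
      (Finset.sum_le_sum_of_subset_of_nonneg (Finset.subset_univ _) fun _ _ _ => by positivity)
    have hz : w < |(imbalance z : ℝ)| := by simpa using hz
    rw [← sq_abs (imbalance z : ℝ)]
    exact pow_le_pow_left₀ hw.le hz.le 2
  rw [inv_mul_le_iff₀ (by positivity), mul_div_assoc', le_div_iff₀ (by positivity)]
  linarith

/-! ### Asymptotics of the expected number of ties -/

lemma eventually_factorial_le :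
    ∀ᶠ k : ℕ in atTop, (k.factorial : ℝ) ≤ 2 * (√(2 * k) * (k / Real.exp 1) ^ k) := by
  have h1 : √Real.pi < 2 := by
    rw [Real.sqrt_lt' two_pos]
    linarith [Real.pi_lt_four]
  filter_upwards [Stirling.tendsto_stirlingSeq_sqrt_pi.eventually_le_const h1,
    eventually_gt_atTop 0] with k hk hk0
  have hk0' : (0 : ℝ) < k := by exact_mod_cast hk0
  rwa [Stirling.stirlingSeq, div_le_iff₀ (by positivity)] at hk

/-- Stirling's bound makes `k ^ k / k!` at least `exp k / (2 * √(2 * k))`; rounding `x` down to `k`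
costs at most a factor `e`. -/
lemma exp_le_pow_div_factorial {x : ℝ} {k : ℕ} (hk : 0 < k) (hkx : (k : ℝ) ≤ x) (hxk : x < k + 1)
    (hfac : (k.factorial : ℝ) ≤ 2 * (√(2 * k) * (k / Real.exp 1) ^ k)) :
    Real.exp (x - 1) / (2 * √(2 * x)) ≤ x ^ k / k.factorial := by
  have hk' : (0 : ℝ) < k := by exact_mod_cast hk
  have hx : 0 < x := hk'.trans_le hkx
  calc Real.exp (x - 1) / (2 * √(2 * x)) ≤ Real.exp k / (2 * √(2 * k)) := by
        gcongr
        linarith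
    _ = (k : ℝ) ^ k / (2 * (√(2 * k) * (k / Real.exp 1) ^ k)) := by
        rw [div_pow, ← Real.exp_nat_mul, mul_one]
        field_simp
    _ ≤ x ^ k / k.factorial := by gcongr

/-- Poisson lower bound for a binomial probability, from `C(m,k) * k! ≥ (m + 1 - k) ^ k` and `1 - u
≥ exp (-(u / (1 - u)))`. -/
lemma choose_mul_countWeight_ge {m k : ℕ} {u r y : ℝ} (hu : 0 ≤ u) (hu1 : u < 1)
    (hr : 0 ≤ r) (hr' : r ≤ ((m : ℝ) + 1 - k) * u) (hk : k ≤ m) (hy : m * u ≤ y * (1 - u)) :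
    r ^ k / k.factorial * Real.exp (-y) ≤ m.choose k * countWeight u m k := by
  have h1 : r ^ k / k.factorial ≤ m.choose k * u ^ k := by
    rw [div_le_iff₀ (by positivity)]
    have h2 : ((m : ℝ) + 1 - k) ^ k ≤ m.choose k * k.factorial := by
      have := Nat.pow_sub_le_descFactorial m k
      rw [Nat.descFactorial_eq_factorial_mul_choose, mul_comm] at this
      have h3 : (((m + 1 - k : ℕ) : ℝ)) = (m : ℝ) + 1 - k := by
        rw [Nat.cast_sub (by omega)]; push_cast; ring
      rw [← h3]
      exact_mod_cast this
    calc r ^ k ≤ (((m : ℝ) + 1 - k) * u) ^ k := pow_le_pow_left₀ hr hr' k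
      _ = ((m : ℝ) + 1 - k) ^ k * u ^ k := mul_pow _ _ _
      _ ≤ m.choose k * k.factorial * u ^ k := mul_le_mul_of_nonneg_right h2 (by positivity)
      _ = _ := by ring
  have hu' : 0 < 1 - u := by linarith
  have h4 : Real.exp (-y) ≤ (1 - u) ^ (m - k) := by
    have h5 : Real.exp (-(u / (1 - u))) ≤ 1 - u := by
      rw [Real.exp_neg, inv_le_comm₀ (Real.exp_pos _) hu']
      refine le_trans (le_of_eq ?_) (Real.add_one_le_exp _)
      field_simp
      ring
    calc Real.exp (-y) ≤ Real.exp (m * -(u / (1 - u))) := by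
          rw [Real.exp_le_exp, mul_neg, neg_le_neg_iff, mul_div_assoc', div_le_iff₀ hu']
          exact hy
      _ = Real.exp (-(u / (1 - u))) ^ m := Real.exp_nat_mul _ _
      _ ≤ (1 - u) ^ m := pow_le_pow_left₀ (Real.exp_nonneg _) h5 m
      _ ≤ (1 - u) ^ (m - k) := pow_le_pow_of_le_one hu'.le (by linarith) (Nat.sub_le _ _)
  calc _ ≤ (m.choose k * u ^ k) * (1 - u) ^ (m - k) :=
        mul_le_mul h1 h4 (Real.exp_nonneg _) (by positivity)
    _ = _ := by rw [countWeight]; ring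

/-- The number of neighbours in each community at which ties are counted. -/
noncomputable def tieSize (α β : ℝ) (n : ℕ) : ℕ := ⌊√(α * β) * Real.log n / 2⌋₊

/-- The product of the Poisson weights at `k` with means `α L / 2` and `β L / 2` peaks near their
geometric mean `x`. There it is about `exp (L * (√(αβ) - (α + β) / 2))` up to a factor of order `x`;
`η` absorbs the errors from imbalance and from the Poisson comparison. -/
lemma tie_probability_ge {α β η L x : ℝ} {n m m' k : ℕ} (hα : 0 < α) (hβ : 0 < β) (hη : 0 < η)
    (hη1 : η < 1) (hn : 0 < n) (hL : 0 < L) (hx : x = √(α * β) * L / 2)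
    (hk : 0 < k) (hkx : (k : ℝ) ≤ x) (hxk : x < k + 1)
    (hfac : (k.factorial : ℝ) ≤ 2 * (√(2 * k) * (k / Real.exp 1) ^ k))
    (hαu : α * (L / n) ≤ η) (hβu : β * (L / n) ≤ η)
    (hm : (1 - η) * (n / 2) ≤ (m : ℝ) + 1 - k) (hm' : (1 - η) * (n / 2) ≤ (m' : ℝ) + 1 - k)
    (hkm : k ≤ m) (hkm' : k ≤ m')
    (hM : (m : ℝ) ≤ (1 + η) * (n / 2)) (hM' : (m' : ℝ) ≤ (1 + η) * (n / 2)) :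
    Real.exp (L * (√(α * β) * (1 + Real.log (1 - η)) - (1 + η) / (1 - η) * ((α + β) / 2)) - 2) /
        (8 * x) ≤
      m.choose k * m'.choose k *
        (countWeight (α * (L / n)) m k * countWeight (β * (L / n)) m' k) := by
  have hn' : (0 : ℝ) < n := by exact_mod_cast hn
  have hη' : 0 < 1 - η := by linarith
  have hk' : (0 : ℝ) < k := by exact_mod_cast hk
  have hx0 : 0 < x := hk'.trans_le hkx
  have key (s : ℝ) (l : ℕ) (hs : 0 < s) (hsu : s * (L / n) ≤ η)
      (hl : (1 - η) * (n / 2) ≤ (l : ℝ) + 1 - k) (hkl : k ≤ l) (hl' : (l : ℝ) ≤ (1 + η) * (n / 2)) :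
      ((1 - η) * (s * L / 2)) ^ k / k.factorial * Real.exp (-((1 + η) / (1 - η) * (s * L / 2))) ≤
        l.choose k * countWeight (s * (L / n)) l k := by
    refine choose_mul_countWeight_ge (by positivity) (by linarith) (by positivity) ?_ hkl ?_
    · calc (1 - η) * (s * L / 2) = (1 - η) * (n / 2) * (s * (L / n)) := by field_simp
        _ ≤ _ := mul_le_mul_of_nonneg_right hl (by positivity)
    · calc (l : ℝ) * (s * (L / n)) ≤ (1 + η) * (n / 2) * (s * (L / n)) :=
            mul_le_mul_of_nonneg_right hl' (by positivity)
        _ = (1 + η) / (1 - η) * (s * L / 2) * (1 - η) := by field_simp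
        _ ≤ (1 + η) / (1 - η) * (s * L / 2) * (1 - s * (L / n)) :=
            mul_le_mul_of_nonneg_left (by linarith) (by positivity)
  have h1 := key α m hα hαu hm hkm hM
  have h2 := key β m' hβ hβu hm' hkm' hM'
  have h3 := exp_le_pow_div_factorial hk hkx hxk hfac
  have hlog : Real.log (1 - η) ≤ 0 := Real.log_nonpos hη'.le (by linarith)
  have h4 : Real.exp (x * Real.log (1 - η)) ≤ (1 - η) ^ k := by
    rw [← Real.exp_log (pow_pos hη' k), Real.exp_le_exp, Real.log_pow]
    exact mul_le_mul_of_nonpos_right hkx hlog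
  have hxx : x ^ 2 = (α * L / 2) * (β * L / 2) := by
    rw [hx, div_pow, mul_pow, Real.sq_sqrt (by positivity)]; ring
  -- As `x ^ 2` is the product of the two means, the Stirling bound at `x` squared handles both
  -- factors.
  have h5 : (Real.exp (x * Real.log (1 - η)) * (Real.exp (x - 1) / (2 * √(2 * x)))) ^ 2 ≤
      ((1 - η) * (α * L / 2)) ^ k / k.factorial * (((1 - η) * (β * L / 2)) ^ k / k.factorial) := by
    calc _ ≤ ((1 - η) ^ k * (x ^ k / k.factorial)) ^ 2 := by gcongr
      _ = (1 - η) ^ k * (1 - η) ^ k * (x ^ 2) ^ k / (k.factorial * k.factorial) := by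
          field_simp
          ring
      _ = _ := by
          rw [hxx, mul_pow, mul_pow, mul_pow]
          field_simp
  have hexp : Real.exp (L * (√(α * β) * (1 + Real.log (1 - η)) -
      (1 + η) / (1 - η) * ((α + β) / 2)) - 2) =
      Real.exp (2 * (x * Real.log (1 - η))) * Real.exp (2 * (x - 1)) *
        (Real.exp (-((1 + η) / (1 - η) * (α * L / 2))) *
          Real.exp (-((1 + η) / (1 - η) * (β * L / 2)))) := by
    rw [← Real.exp_add, ← Real.exp_add, ← Real.exp_add, hx]
    congr 1
    ring
  calc _ = (Real.exp (x * Real.log (1 - η)) * (Real.exp (x - 1) / (2 * √(2 * x)))) ^ 2 *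
        (Real.exp (-((1 + η) / (1 - η) * (α * L / 2))) *
          Real.exp (-((1 + η) / (1 - η) * (β * L / 2)))) := by
        rw [hexp, mul_pow, div_pow, mul_pow, Real.sq_sqrt (by positivity), ← Real.exp_nat_mul,
          ← Real.exp_nat_mul]
        push_cast
        ring
    _ ≤ _ := mul_le_mul_of_nonneg_right h5 (by positivity)
    _ = ((1 - η) * (α * L / 2)) ^ k / k.factorial *
          Real.exp (-((1 + η) / (1 - η) * (α * L / 2))) *
        (((1 - η) * (β * L / 2)) ^ k / k.factorial *
          Real.exp (-((1 + η) / (1 - η) * (β * L / 2)))) := by ring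
    _ ≤ m.choose k * countWeight (α * (L / n)) m k *
        (m'.choose k * countWeight (β * (L / n)) m' k) :=
        mul_le_mul h1 h2 (by positivity) (le_trans (by positivity) h1)
    _ = _ := by ring

/-- At `η = 0` the right side is `1 - (√α - √β) ^ 2 / 2 > 0`, and it is continuous there. -/
lemma exists_exponent {α β : ℝ} (hα : 0 < α) (hβ : 0 < β) (hγ : (√α - √β) ^ 2 < 2) :
    ∃ η ε : ℝ, 0 < η ∧ η < 1 ∧ 0 < ε ∧
      2 * ε ≤ 1 + (√(α * β) * (1 + Real.log (1 - η)) - (1 + η) / (1 - η) * ((α + β) / 2)) := by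
  have h0 : 0 < 1 + (√(α * β) * (1 + Real.log (1 - 0)) - (1 + 0) / (1 - 0) * ((α + β) / 2)) := by
    have h1 := Real.sq_sqrt hα.le
    have h2 := Real.sq_sqrt hβ.le
    rw [Real.sqrt_mul hα.le]
    simp only [sub_zero, Real.log_one, add_zero, div_one, mul_one, one_mul]
    nlinarith
  have hcont : ContinuousAt (fun η : ℝ =>
      1 + (√(α * β) * (1 + Real.log (1 - η)) - (1 + η) / (1 - η) * ((α + β) / 2))) 0 := by
    have h1 : ContinuousAt (fun η : ℝ => Real.log (1 - η)) 0 :=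
      ContinuousAt.log (by fun_prop) (by norm_num)
    have h2 : ContinuousAt (fun η : ℝ => (1 + η) / (1 - η)) 0 :=
      ContinuousAt.div (by fun_prop) (by fun_prop) (by norm_num)
    fun_prop
  have hev := (hcont.eventually (lt_mem_nhds (half_lt_self h0))).filter_mono
    (nhdsWithin_le_nhds (s := Set.Ioi 0))
  obtain ⟨η, hη, hη'⟩ := (hev.and (Ioo_mem_nhdsGT (zero_lt_one' ℝ))).exists
  exact ⟨η, _, hη'.1, hη'.2, half_pos (half_pos h0), (by ring_nf at hη ⊢; exact hη.le)⟩

lemma tendsto_log_natCast : Tendsto (fun n : ℕ => Real.log n) atTop atTop :=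
  Real.tendsto_log_atTop.comp tendsto_natCast_atTop_atTop

lemma tendsto_tieSize {α β : ℝ} (hα : 0 < α) (hβ : 0 < β) :
    Tendsto (tieSize α β) atTop atTop := by
  refine tendsto_nat_floor_atTop.comp ?_
  exact (tendsto_log_natCast.const_mul_atTop (by positivity)).atTop_div_const two_pos

lemma tendsto_rpow_div_natCast :
    Tendsto (fun n : ℕ => (n : ℝ) ^ (3 / 4 : ℝ) / n) atTop (𝓝 0) := by
  have h := (tendsto_rpow_neg_atTop (y := 1 / 4) (by norm_num)).comp
    (tendsto_natCast_atTop_atTop (R := ℝ))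
  refine h.congr' ?_
  filter_upwards [eventually_gt_atTop 0] with n hn
  have hn' : (0 : ℝ) < n := by exact_mod_cast hn
  rw [Function.comp_apply, ← Real.rpow_sub_one hn'.ne']
  norm_num

lemma tendsto_rpow_mul_log_div_natCast :
    Tendsto (fun n : ℕ => (n : ℝ) ^ (3 / 4 : ℝ) * (Real.log n / n)) atTop (𝓝 0) := by
  have h := (isLittleO_log_rpow_atTop (r := 1 / 4) (by norm_num)).tendsto_div_nhds_zero.comp
    (tendsto_natCast_atTop_atTop (R := ℝ))
  refine h.congr' ?_
  filter_upwards [eventually_gt_atTop 0] with n hn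
  have hn' : (0 : ℝ) < n := by exact_mod_cast hn
  have h1 : (n : ℝ) ^ (3 / 4 : ℝ) * (n : ℝ) ^ (1 / 4 : ℝ) = n := by
    rw [← Real.rpow_add hn']; norm_num
  have h2 : (0 : ℝ) < (n : ℝ) ^ (3 / 4 : ℝ) := by positivity
  have h3 : (0 : ℝ) < (n : ℝ) ^ (1 / 4 : ℝ) := by positivity
  rw [Function.comp_apply, div_eq_iff h3.ne', mul_assoc, div_mul_eq_mul_div, mul_div_assoc',
    eq_div_iff hn'.ne']
  linear_combination (-Real.log n) * h1

lemma exists_le_sum_configLaw_real_tiedAt {α β : ℝ} (hα : 0 < α) (hβ : 0 < β)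
    (hγ : (√α - √β) ^ 2 < 2) :
    ∃ ε : ℝ, 0 < ε ∧ ∀ᶠ n : ℕ in atTop, ∀ p q : unitInterval,
      (p : ℝ) = α * (Real.log n / n) → (q : ℝ) = β * (Real.log n / n) →
      ∀ z : Labels n, |(imbalance z : ℝ)| ≤ (n : ℝ) ^ (3 / 4 : ℝ) →
        Real.exp (ε * Real.log n) ≤
          ∑ i, (configLaw p q z).real (tiedAt z (tieSize α β n) i) := by
  obtain ⟨η, ε, hη, hη1, hε, hηε⟩ := exists_exponent hα hβ hγ
  refine ⟨ε, hε, ?_⟩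
  have hsmall (s : ℝ) : Tendsto (fun n : ℕ => s * (Real.log n / n)) atTop (𝓝 0) := by
    simpa using tendsto_log_div_natCast.const_mul s
  have hbal : Tendsto (fun n : ℕ => (n : ℝ) ^ (3 / 4 : ℝ) / n +
      √(α * β) * (Real.log n / n)) atTop (𝓝 0) := by
    simpa using tendsto_rpow_div_natCast.add (hsmall _)
  have hexp : Tendsto (fun n : ℕ => Real.exp (ε * Real.log n) / (ε * Real.log n) ^ 1)
      atTop atTop :=
    (Real.tendsto_exp_div_pow_atTop 1).comp (tendsto_log_natCast.const_mul_atTop hε)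
  filter_upwards [(hsmall α).eventually_le_const hη, (hsmall β).eventually_le_const hη,
    hbal.eventually_le_const hη, (tendsto_tieSize hα hβ).eventually eventually_factorial_le,
    (tendsto_tieSize hα hβ).eventually_gt_atTop 0, eventually_gt_atTop 1,
    -- The mean is at least `exp (2 * ε * L - 2) / (8 * x)` with `8 * x = 4 * √(αβ) * L`. This
    -- constant lets one factor `exp (ε * L)` absorb `8 * x * exp 2`.
    hexp.eventually_ge_atTop (4 * √(α * β) * Real.exp 2 / ε)]
    with n hαu hβu hb hfac hk hn hlarge p q hp hq z hz
  have hn0 : (0 : ℝ) < n := by exact_mod_cast (zero_lt_one.trans hn)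
  have hL : 0 < Real.log n := Real.log_pos (by exact_mod_cast hn)
  set L := Real.log n
  set k := tieSize α β n
  set x := √(α * β) * L / 2 with hx
  have hr : 0 < √(α * β) := by positivity
  have hx0 : 0 < x := by positivity
  have hkx : (k : ℝ) ≤ x := Nat.floor_le hx0.le
  have hxk : x < k + 1 := Nat.lt_floor_add_one x
  have hb' : (n : ℝ) ^ (3 / 4 : ℝ) + 2 * x ≤ η * n := by
    rw [← div_le_iff₀ hn0]
    refine le_trans (le_of_eq ?_) hb
    rw [hx]; field_simp
  have hterm (i : Fin n) : Real.exp (L * (√(α * β) * (1 + Real.log (1 - η)) -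
      (1 + η) / (1 - η) * ((α + β) / 2)) - 2) / (8 * x) ≤
      (configLaw p q z).real (tiedAt z k i) := by
    refine le_trans ?_ (le_configLaw_real_tiedAt p q z k i)
    have hsum : ((mates z i).card : ℝ) + (rivals z i).card + 1 = n := by
      exact_mod_cast card_mates_add_card_rivals z i
    have hdiff := abs_le.1 ((abs_card_mates_sub_card_rivals_le z i).trans
      (add_le_add_left hz 1))
    have hpos : 0 < (1 - η) * ((n : ℝ) / 2) := mul_pos (by linarith) (by positivity)
    have hm : (1 - η) * ((n : ℝ) / 2) ≤ ((mates z i).card : ℝ) + 1 - k := by linarith [hdiff.1]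
    have hm' : (1 - η) * ((n : ℝ) / 2) ≤ ((rivals z i).card : ℝ) + 1 - k := by linarith [hdiff.2]
    have hnat (l : ℕ) (hl : (1 - η) * ((n : ℝ) / 2) ≤ (l : ℝ) + 1 - k) : k ≤ l := by
      have : (k : ℝ) < (l + 1 : ℕ) := by push_cast; linarith
      exact Nat.lt_succ_iff.1 (by exact_mod_cast this)
    rw [hp, hq]
    exact tie_probability_ge hα hβ hη hη1 (by omega) hL hx hk hkx hxk hfac hαu hβu hm hm'
      (hnat _ hm) (hnat _ hm') (by linarith [hdiff.2]) (by linarith [hdiff.1])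
  have hsum := Finset.sum_le_sum fun i (_ : i ∈ (Finset.univ : Finset (Fin n))) => hterm i
  refine le_trans ?_ hsum
  rw [Finset.sum_const, Finset.card_univ, Fintype.card_fin, nsmul_eq_mul, mul_div_assoc']
  set D := √(α * β) * (1 + Real.log (1 - η)) - (1 + η) / (1 - η) * ((α + β) / 2)
  have h1 : Real.exp (2 * ε * L - 2) ≤ n * Real.exp (L * D - 2) := by
    conv_rhs => rw [← Real.exp_log hn0, ← Real.exp_add]
    rw [Real.exp_le_exp]
    nlinarith
  have h2 : 4 * √(α * β) * Real.exp 2 * L ≤ Real.exp (ε * L) := by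
    rw [pow_one, le_div_iff₀ (by positivity)] at hlarge
    refine le_trans (le_of_eq ?_) hlarge
    field_simp
  rw [le_div_iff₀ (by positivity)]
  refine le_trans ?_ h1
  have h3 : Real.exp (2 * ε * L - 2) = Real.exp (ε * L) * Real.exp (ε * L) / Real.exp 2 := by
    rw [← Real.exp_add, ← Real.exp_sub]; congr 1; ring
  rw [h3, mul_div_assoc]
  refine mul_le_mul_of_nonneg_left ?_ (Real.exp_nonneg _)
  rw [le_div_iff₀ (Real.exp_pos _)]
  refine le_trans (le_of_eq ?_) h2
  rw [hx]; ring

theorem tendsto_successProb_zero (d : ℕ) {a b σ : ℝ} (ha : 0 < a) (hb : 0 < b)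
    (hγ : (√(kernelConst d σ * a) - √(kernelConst d σ * b)) ^ 2 < 2) (zhat : Estimator) :
    Tendsto (successProb d a b σ zhat) atTop (𝓝 0) := by
  classical
  have hc := kernelConst_pos d σ
  set α := kernelConst d σ * a
  set β := kernelConst d σ * b
  have hα : 0 < α := mul_pos hc ha
  have hβ : 0 < β := mul_pos hc hb
  obtain ⟨ε, hε, hmean⟩ := exists_le_sum_configLaw_real_tiedAt hα hβ hγ
  set s := max α β
  have hs : 0 < s := lt_max_of_lt_left hα
  let t : ℕ → ℝ := fun n => s * (Real.log n / n)
  let m : ℕ → ℝ := fun n => Real.exp (ε * Real.log n)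
  have ht : Tendsto t atTop (𝓝 0) := by
    simpa [t] using tendsto_log_div_natCast.const_mul s
  have hεL : Tendsto (fun n : ℕ => ε * Real.log n) atTop atTop :=
    tendsto_log_natCast.const_mul_atTop hε
  have hm : Tendsto m atTop atTop := Real.tendsto_exp_atTop.comp hεL
  have hflip : Tendsto (fun n : ℕ => ((n : ℝ) ^ (3 / 4 : ℝ) + 1) * t n) atTop (𝓝 0) := by
    have h := (tendsto_rpow_mul_log_div_natCast.const_mul s).add ht
    rw [mul_zero, add_zero] at h
    refine h.congr fun n => ?_
    simp only [t]; ring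
  have hlim1 : Tendsto (fun n : ℕ => (n : ℝ) / ((n : ℝ) ^ (3 / 4 : ℝ)) ^ 2) atTop (𝓝 0) := by
    have h := (tendsto_rpow_neg_atTop (y := 1 / 2) (by norm_num)).comp
      (tendsto_natCast_atTop_atTop (R := ℝ))
    refine h.congr' ?_
    filter_upwards [eventually_gt_atTop 0] with n hn
    have hn' : (0 : ℝ) < n := by exact_mod_cast hn
    rw [Function.comp_apply, ← Real.rpow_natCast, ← Real.rpow_mul hn'.le]
    nth_rewrite 2 [← Real.rpow_one (n : ℝ)]
    rw [← Real.rpow_sub hn']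
    norm_num
  have hlim2 : Tendsto (fun n : ℕ => (1 + √(α * β) * Real.log n) / m n) atTop (𝓝 0) := by
    have h0 := (Real.tendsto_pow_mul_exp_neg_atTop_nhds_zero 0).comp hεL
    have h1 := (Real.tendsto_pow_mul_exp_neg_atTop_nhds_zero 1).comp hεL
    have h := h0.add (h1.const_mul (√(α * β) / ε))
    rw [mul_zero, add_zero] at h
    refine h.congr fun n => ?_
    simp only [m, Function.comp_apply, pow_zero, pow_one, Real.exp_neg]
    field_simp
  have hlim : Tendsto (fun n : ℕ => (n : ℝ) / ((n : ℝ) ^ (3 / 4 : ℝ)) ^ 2 +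
      4 * ((1 + √(α * β) * Real.log n) / m n + t n / (1 - t n)) + 4 / (m n / 2))
      atTop (𝓝 0) := by
    have h3 : Tendsto (fun n => t n / (1 - t n)) atTop (𝓝 0) := by
      have h := ht.div (tendsto_const_nhds.sub ht) (by simp : (1 : ℝ) - 0 ≠ 0)
      rwa [zero_div] at h
    have h4 : Tendsto (fun n => 4 / (m n / 2)) atTop (𝓝 0) :=
      (hm.atTop_div_const two_pos).const_div_atTop 4
    simpa using (hlim1.add ((hlim2.add h3).const_mul 4)).add h4
  refine squeeze_zero' (Eventually.of_forall fun n => measureReal_nonneg) ?_ hlim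
  filter_upwards [eventually_levelProb d ha σ, eventually_levelProb d hb σ, hmean,
    ht.eventually_lt_const one_pos, hflip.eventually_le_const (by norm_num : (0 : ℝ) < 1 / 2),
    eventually_gt_atTop 0] with n hp hq hn ht1 hfl hn0
  have hn' : (0 : ℝ) < n := by exact_mod_cast hn0
  have hL : 0 ≤ Real.log n / n := div_nonneg (Real.log_natCast_nonneg n) hn'.le
  set p := levelProb n d a σ
  set q := levelProb n d b σ
  have hpt : (p : ℝ) ≤ t n := hp ▸ mul_le_mul_of_nonneg_right (le_max_left _ _) hL
  have hqt : (q : ℝ) ≤ t n := hq ▸ mul_le_mul_of_nonneg_right (le_max_right _ _) hL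
  have ht0 : 0 ≤ t n := mul_nonneg hs.le hL
  have hmn : 0 < m n := Real.exp_pos _
  have hk : 1 + 2 * (tieSize α β n : ℝ) ≤ 1 + √(α * β) * Real.log n := by
    have : (tieSize α β n : ℝ) ≤ √(α * β) * Real.log n / 2 :=
      Nat.floor_le (div_nonneg (mul_nonneg (Real.sqrt_nonneg _) (Real.log_natCast_nonneg n))
        zero_le_two)
    linarith
  have hη0 : 0 ≤ 4 * ((1 + √(α * β) * Real.log n) / m n + t n / (1 - t n)) := by
    have h1 : 0 ≤ t n / (1 - t n) := div_nonneg ht0 (by linarith)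
    have h2 : 0 ≤ Real.log n := Real.log_natCast_nonneg n
    positivity
  -- The imbalance has second moment `n`, so it rarely exceeds `w`; yet `w * log n / n → 0`, as the
  -- flipping bound requires. Any exponent strictly between `1/2` and `1` has both properties.
  set w := (n : ℝ) ^ (3 / 4 : ℝ)
  have hw : 0 < w := by positivity
  rw [successProb_eq]
  have hmain := sum_configLaw_real_success_le (p := p) (q := q) (k := tieSize α β n)
    (half_pos hmn) (Finset.univ.filter fun z : Labels n => |(imbalance z : ℝ)| ≤ w)
    (fun ω => zhat n (graphOfPairs ω)) (fun z hz ω i hω => ?_) (fun z hz => ?_) hη0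
  · refine hmain.trans ?_
    rw [Finset.compl_filter]
    gcongr
    exact card_imbalance_gt_le n hw
  · have hz : |(imbalance z : ℝ)| ≤ w := by simpa using hz
    have hdiff := (abs_card_mates_sub_card_rivals_le z i).trans (add_le_add_left hz 1)
    have hw1 : 0 ≤ w + 1 := by positivity
    exact weight_le_two_mul_weight_flipAt hω
      ((mul_le_mul hdiff hpt p.2.1 hw1).trans hfl) ((mul_le_mul hdiff hqt q.2.1 hw1).trans hfl)
  · have hz : |(imbalance z : ℝ)| ≤ w := by simpa using hz
    refine (configLaw_real_tiedCount_lt_le z _ hpt hqt ht1 hmn (hn p q hp hq z hz)).trans ?_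
    gcongr

end LatentKernelSBM

open LatentKernelSBM in
theorem theoremC6 (d : ℕ) (hd : 0 < d) (a b σ : ℝ) (ha : 0 < a) (hb : 0 < b) (hσ : 0 < σ) :
    ((Real.sqrt (kernelConst d σ * a) - Real.sqrt (kernelConst d σ * b)) ^ 2 ≠ 2 →
      (ExactRecoveryAchievable d a b σ ↔
        (Real.sqrt (kernelConst d σ * a) - Real.sqrt (kernelConst d σ * b)) ^ 2 > 2)) ∧
    ((Real.sqrt (kernelConst d σ * a) - Real.sqrt (kernelConst d σ * b)) ^ 2 < 2 →
      ∀ zhat : Estimator, Tendsto (successProb d a b σ zhat) atTop (𝓝 0)) ∧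
    ((Real.sqrt (kernelConst d σ * a) - Real.sqrt (kernelConst d σ * b)) ^ 2 > 2 →
      ∀ zhat : Estimator, IsMLE d a b σ zhat →
        Tendsto (successProb d a b σ zhat) atTop (𝓝 1)) := by
  refine ⟨fun hne => ⟨fun ⟨zhat, hz⟩ => ?_, fun hγ => ?_⟩,
    fun hγ zhat => tendsto_successProb_zero d ha hb hγ zhat,
    fun hγ zhat hz => tendsto_successProb_of_isMLE d ha hb hγ hz⟩
  · by_contra hle
    have h0 := tendsto_successProb_zero d ha hb (lt_of_le_of_ne (not_lt.1 hle) hne) zhat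
    exact zero_ne_one (tendsto_nhds_unique h0 hz)
  · obtain ⟨zhat, hz⟩ := exists_isMLE d a b σ
    exact ⟨zhat, tendsto_successProb_of_isMLE d ha hb hγ hz⟩
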